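/- For $x>0$, $\rho>0$ and real $\alpha$ let \[F(x,\rho,\alpha)=\int_{-\infty}^{\infty}\exp\bigl[-\tfrac12\rho\cosh(2u-i\alpha)\bigr]\cos(x\cosh u)\,du,\qquad M=\frac{x^2}{4\rho}.\] Let $(a)_r=a(a+1)\cdots(a+r-1)$ and let \[\mathbf H_\nu(x)=\sum_{k\ge0}\frac{(-1)^k(x/2)^{2k+\nu+1}}{\Gamma(k+\frac32)\Gamma(k+\nu+\frac32)},\qquad \mathcal H_\nu(x)=(x/2)^{-\nu}\,\mathbf H_\nu(x)\] be the Struve function and the scaled Struve function. Let $Y_m$ be the Bessel function of the second kind, $\mathbf K_m=\mathbf H_m-Y_m$ and $\mathcal K_m(x)=x^m\mathbf K_m(x)$. For integers $k\ge0$ let \[C_k(x)=\frac2\pi\,x^{2k}\int_0^\infty\frac{\xi^{2k}e^{-x\xi}}{\sqrt{1+\xi^2}}\,d\xi .\] (i) For every $x>0$ the integrals $C_m(x)$ $(m\ge0)$ converge and satisfy the recurrence \[C_m(x)=2^m(\tfrac12)_m\,\mathcal K_m(x)-\sum_{r=0}^{m-1}\binom mr x^{2(m-r)}C_r(x)\qquad(m\ge0);\]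 in particular $C_0(x)=\mathcal K_0(x)$. (ii) Let $X,R>0$ (for instance $X=R=1$). There are constants $A,B$, depending only on $X$ and $R$, and constants $K_n$ $(n\ge1)$, depending only on $n$, $X$ and $R$, such that for all $0<x<X$ and $0<\rho<R$ the integral $F(x,\rho,0)$ converges absolutely, the series $\sum_r\frac{(1/2)_r}{r!}\rho^r\mathcal H_r(x)$ converges absolutely, and for every positive integer $n<M$ \[F(x,\rho,0)=-\pi e^{-\rho/2}\sum_{r=0}^\infty\frac{(\frac12)_r}{r!}\,\rho^r\mathcal H_r(x)+\pi e^{\rho/2}\Bigl\{\sum_{k=0}^{n-1}\frac{M^{-k}}{2^{2k}k!}\,C_k(x)+E_1\Bigr\}+E_2+E_3\] with $|E_1|\le K_nM^{-n}$, $|E_2|\le A\,e^{-M}$ and $|E_3|\le B\,M^{-1}e^{-M}$. That is, for fixed $n$ the errors are $O(M^{-n})$ inside the braces and $O(e^{-M})+O(M^{-1}e^{-M})$ outside, as $M\to\infty$, uniformly in $x$ and $\rho$. -/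

import Mathlib

noncomputable section

namespace KelvinWave

open MeasureTheory

/-- The integrand of the Kelvin ship-wave integral. -/
def integrand (x ρ α u : ℝ) : ℂ :=
  Complex.exp (-((ρ : ℂ) / 2) * Complex.cosh (2 * (u : ℂ) - Complex.I * (α : ℂ))) *
    Complex.cos ((x : ℂ) * Complex.cosh (u : ℂ))

/-- `F(x, ρ, α) = ∫_{-∞}^{∞} exp[-(ρ/2) cosh(2u - iα)] cos(x cosh u) du`. -/
def F (x ρ α : ℝ) : ℂ := ∫ u : ℝ, integrand x ρ α u

/-- The large parameter `M = x² / (4ρ)`. -/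
def bigM (x ρ : ℝ) : ℝ := x ^ 2 / (4 * ρ)

/-- Pochhammer's symbol `(a)_r = a (a + 1) ⋯ (a + r - 1)`. -/
def poch (a : ℝ) (r : ℕ) : ℝ := (ascPochhammer ℝ r).eval a

/-- The Struve function `𝐇_ν(x)`, for `x > 0`. -/
def struveH (ν x : ℝ) : ℝ :=
  ∑' k : ℕ, (-1) ^ k * (x / 2) ^ (2 * (k : ℝ) + ν + 1) /
    (Real.Gamma (k + 3 / 2) * Real.Gamma (k + ν + 3 / 2))

/-- The scaled Struve function `(x/2)^{-ν} 𝐇_ν(x)`. -/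
def scaledStruve (ν x : ℝ) : ℝ := (x / 2) ^ (-ν) * struveH ν x

/-- The Bessel function of the first kind `J_n(x)`, of integer order `n ≥ 0`. -/
def besselJ (n : ℕ) (x : ℝ) : ℝ :=
  ∑' k : ℕ, (-1) ^ k * (x / 2) ^ (2 * k + n) / ((k.factorial : ℝ) * ((n + k).factorial : ℝ))

/-- The digamma function at a positive integer, `ψ(j + 1) = 1 + 1/2 + ⋯ + 1/j - γ`. -/
def digammaSucc (j : ℕ) : ℝ := (harmonic j : ℝ) - Real.eulerMascheroniConstant

/-- The Bessel function of the second kind `Y_n(x)`, of integer order `n ≥ 0`, for `x > 0`,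
by its standard series
`π Y_n(x) = 2 log(x/2) J_n(x) - (x/2)^{-n} ∑_{k<n} (n-k-1)!/k! (x²/4)^k
  - (x/2)^n ∑_k (ψ(k+1) + ψ(n+k+1)) (-x²/4)^k / (k! (n+k)!)`. -/
def besselY (n : ℕ) (x : ℝ) : ℝ :=
  (2 * Real.log (x / 2) * besselJ n x
    - ((x / 2) ^ n)⁻¹ *
        ∑ k ∈ Finset.range n,
          ((n - k - 1).factorial : ℝ) / (k.factorial : ℝ) * (x ^ 2 / 4) ^ k
    - (x / 2) ^ n *
        ∑' k : ℕ, (digammaSucc k + digammaSucc (n + k)) * (-(x ^ 2 / 4)) ^ k /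
          ((k.factorial : ℝ) * ((n + k).factorial : ℝ))) / Real.pi

/-- The Struve function `𝐊_m(x) = 𝐇_m(x) - Y_m(x)`, of integer order `m ≥ 0`. -/
def struveK (m : ℕ) (x : ℝ) : ℝ := struveH m x - besselY m x

/-- `𝓚_m(x) = x^m 𝐊_m(x)`. -/
def scaledK (m : ℕ) (x : ℝ) : ℝ := x ^ m * struveK m x

/-- The integrand of the Laplace-type integral in `C_k(x)`. -/
def coeffIntegrand (k : ℕ) (x ξ : ℝ) : ℝ :=
  ξ ^ (2 * k) * Real.exp (-x * ξ) / √(1 + ξ ^ 2)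

/-- `C_k(x) = (2/π) x^{2k} ∫_0^∞ ξ^{2k} e^{-xξ} / √(1 + ξ²) dξ`. -/
def coeffC (k : ℕ) (x : ℝ) : ℝ :=
  2 / Real.pi * x ^ (2 * k) * ∫ ξ in Set.Ioi (0 : ℝ), coeffIntegrand k x ξ

/-- The terms of the convergent Struve series, `((1/2)_r / r!) ρ^r 𝓗_r(x)`. -/
def struveTerm (x ρ : ℝ) (r : ℕ) : ℝ :=
  poch (1 / 2) r / (r.factorial : ℝ) * ρ ^ r * scaledStruve r x

/-- The truncated asymptotic series `∑_{k<n} M^{-k} C_k(x) / (2^{2k} k!)`. -/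
def asympSum (x ρ : ℝ) (n : ℕ) : ℝ :=
  ∑ k ∈ Finset.range n,
    (bigM x ρ ^ k)⁻¹ / (2 ^ (2 * k) * (k.factorial : ℝ)) * coeffC k x

end KelvinWave

end

noncomputable section

namespace KelvinWave

open MeasureTheory Filter Topology Set

/-! Part (i). Let `G_p(x) = ∫_0^∞ (x² + s²)^p e^{-s} ds` (`laplaceG`). Scaling `s = xξ` and
expanding `(1 + ξ²)^m` turns the binomial sum of the `C_r`, `r ≤ m`, into `(2/π) G_{m-1/2}`
(`sum_choose_mul_coeffC`), so the recurrence amounts to the classical Laplace representation of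
`𝓚_m` (`laplaceG_eq_scaledK`). As `Y_m` is given by its series, that representation is proved by
differential equations. The two sides satisfy the same derivative recursion in `m`
(`hasDerivAt_laplaceG`, `hasDerivAt_scaledK_succ`) and have the same behaviour at `0+`. For `m = 0`
the differences in orders 0 and 1 form a closed homogeneous system, and an energy argument gives
uniqueness at its singular point (`eq_zero_of_bessel_system`).

Part (ii). Since `cosh 2u = 2 cosh² u - 1`, `F` is `2 e^{ρ/2}` times the integral over `(0, ∞)` of
the real part of `exp(-ρ cosh² u + i x cosh u)`. Apply Cauchy's theorem on `[0, a] × [0, π/2]` with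
`sinh a = x/(2ρ)` (`integral_wave_rect`). The left side produces the Struve series through Poisson's
integral (`hasSum_struveTerm`). On the top side `cosh` becomes `i sinh`, and `ξ = sinh t` gives a
Laplace integral with real exponent `ρξ² - xξ`, which decreases to `-M` exactly at the corner. The
right side is therefore `O(e^{-M})`, and the part of the real axis beyond `a` is `O(M^{-1} e^{-M})`.

Expanding `e^{ρξ²}` under the Laplace integral gives the terms in `C_k`. The remainder is uniform
because `ρξ² ≤ xξ/2` on the range of integration, so half of the decay of `e^{-xξ}` survives
(`abs_asymp_remainder_le`). -/

/-! ### Power series in `x/2`: termwise differentiation -/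

lemma abs_half_pow_deriv_le {c : ℕ → ℝ} {C : ℝ} (hc : ∀ k, |c k| ≤ C / k.factorial)
    (p k : ℕ) {r y : ℝ} (hr1 : 1 ≤ r) (hy : |y| ≤ r) :
    ‖c k * (k + p / 2) * (y / 2) ^ (2 * k + p - 1)‖ ≤
      C * (1 + p) * r ^ p * ((2 * r ^ 2) ^ k / k.factorial) := by
  have hy' : |y / 2| ≤ r := by
    rw [abs_div, abs_two]
    linarith [abs_nonneg y]
  -- The factor `k` created by differentiation is absorbed into `2 ^ k`, so that the majorant is
  -- still an exponential series.
  have h2 : (k : ℝ) ≤ 2 ^ k := by exact_mod_cast Nat.lt_two_pow_self.le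
  have h1 : (1 : ℝ) ≤ 2 ^ k := one_le_pow₀ (by norm_num)
  have hp : (0 : ℝ) ≤ p := p.cast_nonneg
  have hk : |(k : ℝ) + p / 2| ≤ (1 + p) * 2 ^ k := by
    rw [abs_of_nonneg (by positivity)]
    nlinarith
  have hpow : |y / 2| ^ (2 * k + p - 1) ≤ r ^ (2 * k + p) :=
    (pow_le_pow_left₀ (abs_nonneg _) hy' _).trans (pow_le_pow_right₀ hr1 (by omega))
  rw [Real.norm_eq_abs, abs_mul, abs_mul, abs_pow]
  calc |c k| * |(k : ℝ) + p / 2| * |y / 2| ^ (2 * k + p - 1)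
      ≤ (C / k.factorial) * ((1 + p) * 2 ^ k) * r ^ (2 * k + p) := by
        have := (abs_nonneg _).trans (hc k)
        gcongr
        exact hc k
    _ = _ := by rw [mul_pow, pow_add, pow_mul]; ring

lemma summable_half_pow_deriv {c : ℕ → ℝ} {C : ℝ} (hc : ∀ k, |c k| ≤ C / k.factorial)
    (p : ℕ) (x : ℝ) : Summable fun k : ℕ => c k * (k + p / 2) * (x / 2) ^ (2 * k + p - 1) :=
  Summable.of_norm_bounded ((Real.summable_pow_div_factorial _).mul_left _)
    fun k => abs_half_pow_deriv_le hc p k (r := |x| + 1) (by simp) (by simp)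

/-- Termwise differentiation of `∑ c_k (x/2)^{2k+p}` when `c_k = O(1/k!)`. -/
lemma hasDerivAt_tsum_half_pow {c : ℕ → ℝ} {C : ℝ} (hc : ∀ k, |c k| ≤ C / k.factorial)
    (p : ℕ) (x : ℝ) :
    HasDerivAt (fun x : ℝ => ∑' k : ℕ, c k * (x / 2) ^ (2 * k + p))
      (∑' k : ℕ, c k * (k + p / 2) * (x / 2) ^ (2 * k + p - 1)) x := by
  refine hasDerivAt_tsum_of_isPreconnected
    (g := fun (k : ℕ) (y : ℝ) => c k * (y / 2) ^ (2 * k + p))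
    (g' := fun (k : ℕ) (y : ℝ) => c k * (k + p / 2) * (y / 2) ^ (2 * k + p - 1))
    (u := fun k : ℕ => C * (1 + p) * (|x| + 1) ^ p * ((2 * (|x| + 1) ^ 2) ^ k / k.factorial))
    (t := Metric.ball (0 : ℝ) (|x| + 1)) (y₀ := (0 : ℝ))
    ((Real.summable_pow_div_factorial _).mul_left _) Metric.isOpen_ball
    (convex_ball (0 : ℝ) (|x| + 1)).isPreconnected ?_ ?_ ?_ ?_ ?_
  · intro k y _
    have h : HasDerivAt (fun y : ℝ => c k * (y / 2) ^ (2 * k + p)) _ y :=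
      (((hasDerivAt_id' y).div_const 2).pow (2 * k + p)).const_mul (c k)
    refine h.congr_deriv ?_
    push_cast
    ring
  · intro k y hy
    have hy' : |y| < |x| + 1 := by simpa using hy
    exact abs_half_pow_deriv_le hc p k (by simp) hy'.le
  · simp only [Metric.mem_ball, dist_self]; positivity
  -- At the base point 0 every term with `k ≠ 0` vanishes.
  · apply summable_of_ne_finset_zero (s := {0})
    intro k hk
    have : 2 * k + p ≠ 0 := by simp at hk; omega
    simp only [zero_div, zero_pow this, mul_zero]
  · simp

lemma summable_half_pow {c : ℕ → ℝ} {C : ℝ} (hc : ∀ k, |c k| ≤ C / k.factorial)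
    (p : ℕ) (x : ℝ) : Summable fun k : ℕ => c k * (x / 2) ^ (2 * k + p) := by
  refine Summable.of_norm_bounded (g := fun k => C * |x / 2| ^ p *
    ((|x / 2| ^ 2) ^ k / k.factorial)) ((Real.summable_pow_div_factorial _).mul_left _) ?_
  intro k
  rw [Real.norm_eq_abs, abs_mul, abs_pow]
  calc |c k| * |x / 2| ^ (2 * k + p) ≤ C / k.factorial * |x / 2| ^ (2 * k + p) := by
        gcongr; exact hc k
    _ = _ := by rw [pow_add, pow_mul]; ring

/-! ### The series of `𝐇_m`, `J_m` and `Y_m`, multiplied by `(x/2)^m` -/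

/-- `Γ` is increasing on `[2, ∞)`, but `k + 3/2` may lie below 2; hence the comparison of `Γ(k + 2)`
with `Γ(k + 5/2)`, followed by one step of the functional equation. -/
lemma half_factorial_le_Gamma (k : ℕ) : (k.factorial : ℝ) / 2 ≤ Real.Gamma (k + 3 / 2) := by
  have h : Real.Gamma ((k : ℝ) + 2) ≤ Real.Gamma ((k : ℝ) + 3 / 2 + 1) := by
    have hk : (0 : ℝ) ≤ k := k.cast_nonneg
    exact Real.Gamma_strictMonoOn_Ici.monotoneOn (mem_Ici.2 (by linarith))
      (mem_Ici.2 (by linarith)) (by linarith)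
  rw [Real.Gamma_add_one (by positivity), show (k : ℝ) + 2 = ((k + 1 : ℕ) : ℝ) + 1 by push_cast; ring,
    Real.Gamma_nat_eq_factorial, Nat.factorial_succ] at h
  push_cast at h
  have hk : (0 : ℝ) ≤ k := k.cast_nonneg
  have hf : (0 : ℝ) < k.factorial := by positivity
  have h3 : ((k : ℝ) + 3 / 2) * (k.factorial / 2) ≤ ((k : ℝ) + 3 / 2) * Real.Gamma (k + 3 / 2) := by
    nlinarith
  exact le_of_mul_le_mul_left h3 (by positivity)

/-- Coefficients of `(x/2)^m 𝐇_m(x)`. -/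
def hCoeff (m k : ℕ) : ℝ :=
  (-1) ^ k / (Real.Gamma (k + 3 / 2) * Real.Gamma (k + m + 3 / 2))

/-- Coefficients of `(x/2)^m J_m(x)`. -/
def jCoeff (m k : ℕ) : ℝ := (-1) ^ k / ((k.factorial : ℝ) * ((m + k).factorial : ℝ))

/-- Coefficients of the digamma series in `(x/2)^m Y_m(x)`. -/
def psiCoeff (m k : ℕ) : ℝ :=
  (digammaSucc k + digammaSucc (m + k)) * (-1) ^ k /
    ((k.factorial : ℝ) * ((m + k).factorial : ℝ))

lemma abs_hCoeff_le (m k : ℕ) : |hCoeff m k| ≤ 4 / k.factorial := by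
  have h1 := half_factorial_le_Gamma k
  have h2 := half_factorial_le_Gamma (k + m)
  have hf : (0 : ℝ) < k.factorial := by positivity
  have hf2 : (1 : ℝ) ≤ (k + m).factorial := by exact_mod_cast Nat.factorial_pos _
  push_cast at h2
  have h : (k.factorial : ℝ) / 2 * (1 / 2) ≤
      Real.Gamma (k + 3 / 2) * Real.Gamma (k + m + 3 / 2) := by
    apply mul_le_mul h1 (by linarith) (by norm_num) (by linarith)
  have hpos := lt_of_lt_of_le (by positivity) h
  rw [hCoeff, abs_div, abs_pow, abs_neg, abs_one, one_pow, abs_of_pos hpos,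
    div_le_div_iff₀ hpos hf]
  linarith

lemma abs_jCoeff_le (m k : ℕ) : |jCoeff m k| ≤ 1 / k.factorial := by
  have hf : (0 : ℝ) < k.factorial := by positivity
  have hf2 : (1 : ℝ) ≤ (m + k).factorial := by exact_mod_cast Nat.factorial_pos _
  rw [jCoeff, abs_div, abs_pow, abs_neg, abs_one, one_pow, abs_of_pos (by positivity)]
  apply one_div_le_one_div_of_le hf
  nlinarith

lemma harmonic_le_self (k : ℕ) : (harmonic k : ℝ) ≤ k := by
  induction k with
  | zero => simp
  | succ k ih =>
    rw [harmonic_succ]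
    push_cast
    have : ((k : ℝ) + 1)⁻¹ ≤ 1 := inv_le_one_of_one_le₀ (by linarith [k.cast_nonneg (α := ℝ)])
    linarith

lemma abs_digammaSucc_le (k : ℕ) : |digammaSucc k| ≤ k + 1 := by
  have h1 := harmonic_le_self k
  have h0 : (0 : ℝ) ≤ harmonic k := by
    rw [harmonic]; push_cast; positivity
  have h2 := Real.one_half_lt_eulerMascheroniConstant
  have h3 := Real.eulerMascheroniConstant_lt_two_thirds
  rw [digammaSucc, abs_le]
  constructor <;> linarith [k.cast_nonneg (α := ℝ)]

lemma digammaSucc_succ (k : ℕ) : digammaSucc (k + 1) = digammaSucc k + 1 / (k + 1) := by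
  rw [digammaSucc, digammaSucc, harmonic_succ]
  push_cast
  ring

lemma abs_psiCoeff_le (m k : ℕ) : |psiCoeff m k| ≤ 4 / k.factorial := by
  have hf : (0 : ℝ) < k.factorial := by positivity
  have hf2 : (1 : ℝ) ≤ (m + k).factorial := by exact_mod_cast Nat.factorial_pos _
  have hf3 : ((m : ℝ) + k) ≤ (m + k).factorial := by exact_mod_cast Nat.self_le_factorial _
  have hm : (0 : ℝ) ≤ m := m.cast_nonneg
  have h : |digammaSucc k + digammaSucc (m + k)| ≤ 4 * (m + k).factorial := by
    have h1 := abs_digammaSucc_le k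
    have h2 := abs_digammaSucc_le (m + k)
    push_cast at h2
    linarith [abs_add_le (digammaSucc k) (digammaSucc (m + k))]
  rw [psiCoeff, abs_div, abs_mul, abs_pow, abs_neg, abs_one, one_pow, mul_one,
    abs_of_pos (by positivity : (0 : ℝ) < k.factorial * (m + k).factorial),
    div_le_div_iff₀ (by positivity) hf]
  nlinarith

/-- `(x/2)^m 𝐇_m(x)`. -/
def hSeries (m : ℕ) (x : ℝ) : ℝ := ∑' k : ℕ, hCoeff m k * (x / 2) ^ (2 * k + (2 * m + 1))

/-- `(x/2)^m J_m(x)`. -/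
def jSeries (m : ℕ) (x : ℝ) : ℝ := ∑' k : ℕ, jCoeff m k * (x / 2) ^ (2 * k + 2 * m)

/-- The digamma part of `(x/2)^m Y_m(x)`. -/
def psiSeries (m : ℕ) (x : ℝ) : ℝ := ∑' k : ℕ, psiCoeff m k * (x / 2) ^ (2 * k + 2 * m)

/-- The polynomial part of `(x/2)^m Y_m(x)`. -/
def yPoly (m : ℕ) (x : ℝ) : ℝ :=
  ∑ k ∈ Finset.range m, ((m - k - 1).factorial : ℝ) / (k.factorial : ℝ) * (x ^ 2 / 4) ^ k

/-- The factor `(x/2)^m` removes the negative powers of `x` from `Y_m`, leaving entire series, a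
polynomial and a single logarithm. -/
lemma scaledK_eq (m : ℕ) {x : ℝ} (hx : 0 < x) :
    scaledK m x = 2 ^ m * (hSeries m x -
      (2 * Real.log (x / 2) * jSeries m x - yPoly m x - psiSeries m x) / Real.pi) := by
  have hx2 : 0 < x / 2 := by positivity
  have hH : (x / 2) ^ m * struveH m x = hSeries m x := by
    rw [struveH, hSeries, ← tsum_mul_left]
    refine tsum_congr fun k => ?_
    rw [show (2 * (k : ℝ) + m + 1) = ((2 * k + m + 1 : ℕ) : ℝ) by push_cast; ring,
      Real.rpow_natCast, hCoeff]
    ring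
  have hJ : (x / 2) ^ m * besselJ m x = jSeries m x := by
    rw [besselJ, jSeries, ← tsum_mul_left]
    refine tsum_congr fun k => ?_
    rw [jCoeff]
    ring
  have hP : (x / 2) ^ m * ((x / 2) ^ m * ∑' k : ℕ, (digammaSucc k + digammaSucc (m + k)) *
      (-(x ^ 2 / 4)) ^ k / ((k.factorial : ℝ) * ((m + k).factorial : ℝ))) = psiSeries m x := by
    rw [psiSeries, ← tsum_mul_left, ← tsum_mul_left]
    refine tsum_congr fun k => ?_
    rw [psiCoeff, neg_pow (x ^ 2 / 4), show x ^ 2 / 4 = (x / 2) ^ 2 by ring, ← pow_mul]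
    ring
  have hQ : (x / 2) ^ m * (((x / 2) ^ m)⁻¹ * yPoly m x) = yPoly m x := by
    rw [← mul_assoc, mul_inv_cancel₀ (by positivity), one_mul]
  have : x ^ m = 2 ^ m * (x / 2) ^ m := by rw [← mul_pow]; congr 1; ring
  rw [scaledK, struveK, besselY, this, ← hH, ← hJ, ← hP, ← hQ]
  simp only [yPoly]
  ring

/-! ### Derivative recursions for the series and for `𝓚_m` -/

lemma Gamma_half_step (a : ℕ) :
    Real.Gamma ((a : ℝ) + 1 + 3 / 2) = (a + 3 / 2) * Real.Gamma (a + 3 / 2) := by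
  rw [← Real.Gamma_add_one (by positivity)]; congr 1; ring

lemma hasDerivAt_hSeries_succ (m : ℕ) (x : ℝ) :
    HasDerivAt (hSeries (m + 1)) (x / 2 * hSeries m x) x := by
  refine (hasDerivAt_tsum_half_pow (abs_hCoeff_le (m + 1)) (2 * (m + 1) + 1) x).congr_deriv ?_
  symm
  rw [hSeries, ← tsum_mul_left]
  refine tsum_congr fun k => ?_
  have h : Real.Gamma (k + (m + 1 : ℕ) + 3 / 2) =
      (k + m + 3 / 2) * Real.Gamma (k + m + 3 / 2) := by
    have := Gamma_half_step (k + m)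
    push_cast at this ⊢
    rw [← add_assoc]; exact this
  have h1 : Real.Gamma (k + 3 / 2) ≠ 0 := (Real.Gamma_pos_of_pos (by positivity)).ne'
  have h2 : Real.Gamma ((k : ℝ) + m + 3 / 2) ≠ 0 := (Real.Gamma_pos_of_pos (by positivity)).ne'
  rw [show 2 * k + (2 * (m + 1) + 1) - 1 = 2 * k + (2 * m + 1) + 1 by omega, pow_succ,
    hCoeff, hCoeff, h]
  push_cast
  field_simp
  ring

lemma hasDerivAt_jSeries_succ (m : ℕ) (x : ℝ) :
    HasDerivAt (jSeries (m + 1)) (x / 2 * jSeries m x) x := by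
  refine (hasDerivAt_tsum_half_pow (abs_jCoeff_le (m + 1)) (2 * (m + 1)) x).congr_deriv ?_
  symm
  rw [jSeries, ← tsum_mul_left]
  refine tsum_congr fun k => ?_
  rw [show 2 * k + 2 * (m + 1) - 1 = 2 * k + 2 * m + 1 by omega, pow_succ,
    jCoeff, jCoeff, show m + 1 + k = m + k + 1 by omega, Nat.factorial_succ]
  push_cast
  field_simp
  ring

/-- The extra term in `jSeries` comes from `ψ(m+k+2) = ψ(m+k+1) + 1/(m+k+1)`. It cancels the term
produced by differentiating the logarithm in `hasDerivAt_scaledK_succ`. -/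
lemma hasDerivAt_psiSeries_succ (m : ℕ) {x : ℝ} (hx : x ≠ 0) :
    HasDerivAt (psiSeries (m + 1)) (x / 2 * psiSeries m x + 2 / x * jSeries (m + 1) x) x := by
  refine (hasDerivAt_tsum_half_pow (abs_psiCoeff_le (m + 1)) (2 * (m + 1)) x).congr_deriv ?_
  symm
  rw [psiSeries, jSeries, ← tsum_mul_left, ← tsum_mul_left, ← Summable.tsum_add
    ((summable_half_pow (abs_psiCoeff_le m) _ x).mul_left _)
    ((summable_half_pow (abs_jCoeff_le (m + 1)) _ x).mul_left _)]
  refine tsum_congr fun k => ?_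
  rw [show 2 * k + 2 * (m + 1) - 1 = 2 * k + 2 * m + 1 by omega,
    show 2 * k + 2 * (m + 1) = 2 * k + 2 * m + 1 + 1 by omega, pow_succ, pow_succ,
    psiCoeff, psiCoeff, jCoeff, show m + 1 + k = m + k + 1 by omega, Nat.factorial_succ,
    digammaSucc_succ]
  push_cast
  field_simp
  ring

lemma hasDerivAt_yPoly_succ (m : ℕ) (x : ℝ) :
    HasDerivAt (yPoly (m + 1)) (x / 2 * yPoly m x) x := by
  have h : HasDerivAt (yPoly (m + 1)) (∑ k ∈ Finset.range (m + 1),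
      ((m + 1 - k - 1).factorial : ℝ) / (k.factorial : ℝ) *
        (k * (x ^ 2 / 4) ^ (k - 1) * (x / 2))) x := by
    refine HasDerivAt.fun_sum fun k _ => HasDerivAt.const_mul _ ?_
    have h := ((hasDerivAt_pow 2 x).div_const 4).pow k
    refine h.congr_deriv ?_
    push_cast
    ring
  refine h.congr_deriv ?_
  rw [Finset.sum_range_succ', yPoly, Finset.mul_sum]
  simp only [Nat.cast_zero, zero_mul, mul_zero, add_zero]
  refine Finset.sum_congr rfl fun k _ => ?_
  rw [show m + 1 - (k + 1) - 1 = m - k - 1 by omega, Nat.factorial_succ, Nat.add_sub_cancel]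
  push_cast
  field_simp

lemma hasDerivAt_log_half {x : ℝ} (hx : 0 < x) :
    HasDerivAt (fun x : ℝ => Real.log (x / 2)) (1 / x) x := by
  refine (((hasDerivAt_id' x).div_const 2).log (by positivity)).congr_deriv ?_
  field_simp

lemma hasDerivAt_scaledK_succ (m : ℕ) {x : ℝ} (hx : 0 < x) :
    HasDerivAt (scaledK (m + 1)) (x * scaledK m x) x := by
  have h := ((hasDerivAt_hSeries_succ m x).sub
    ((((((hasDerivAt_log_half hx).const_mul 2).mul (hasDerivAt_jSeries_succ m x)).sub
      (hasDerivAt_yPoly_succ m x)).sub (hasDerivAt_psiSeries_succ m hx.ne')).div_const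
        Real.pi)).const_mul (2 ^ (m + 1) : ℝ)
  refine (h.congr_of_eventuallyEq ?_).congr_deriv ?_
  · filter_upwards [lt_mem_nhds hx] with y hy
    exact scaledK_eq _ hy
  · rw [scaledK_eq m hx]
    field_simp
    ring

/-- The inhomogeneous `2/π` is the `k = 0` term, `1 / (2 Γ(3/2)²)`; the others shift to order 1. -/
lemma hasDerivAt_hSeries_zero {x : ℝ} (hx : x ≠ 0) :
    HasDerivAt (hSeries 0) (2 / Real.pi - 2 / x * hSeries 1 x) x := by
  refine (hasDerivAt_tsum_half_pow (abs_hCoeff_le 0) (2 * 0 + 1) x).congr_deriv ?_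
  rw [(summable_half_pow_deriv (abs_hCoeff_le 0) (2 * 0 + 1) x).tsum_eq_zero_add, sub_eq_add_neg,
    hSeries, ← tsum_mul_left, ← tsum_neg]
  have hG : Real.Gamma (3 / 2) = √Real.pi / 2 := by
    rw [show (3 / 2 : ℝ) = 1 / 2 + 1 by norm_num, Real.Gamma_add_one (by norm_num),
      Real.Gamma_one_half_eq]
    ring
  congr 1
  · have hp : √Real.pi * √Real.pi = Real.pi := Real.mul_self_sqrt Real.pi_pos.le
    simp only [hCoeff, Nat.cast_zero, zero_add, hG, pow_zero, mul_zero, add_zero]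
    rw [div_mul_div_comm (√Real.pi), hp]
    field_simp
    norm_num
  · refine tsum_congr fun k => ?_
    have h := Gamma_half_step k
    have h1 : Real.Gamma (k + 3 / 2) ≠ 0 := (Real.Gamma_pos_of_pos (by positivity)).ne'
    simp only [hCoeff]
    push_cast
    rw [add_zero, h, show 2 * (k + 1) = 2 * k + 2 by omega,
      show 2 * k + 3 = 2 * k + 2 + 1 by omega, pow_succ (x / 2) (2 * k + 2), pow_succ (-1)]
    field_simp
    ring

lemma hasDerivAt_jSeries_zero {x : ℝ} (hx : x ≠ 0) :
    HasDerivAt (jSeries 0) (- (2 / x * jSeries 1 x)) x := by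
  refine (hasDerivAt_tsum_half_pow (abs_jCoeff_le 0) (2 * 0) x).congr_deriv ?_
  rw [(summable_half_pow_deriv (abs_jCoeff_le 0) (2 * 0) x).tsum_eq_zero_add,
    jSeries, ← tsum_mul_left, ← tsum_neg]
  simp only [Nat.cast_zero, mul_zero, zero_div, add_zero, zero_mul, zero_add]
  refine tsum_congr fun k => ?_
  simp only [jCoeff, zero_add, add_comm 1 k, Nat.factorial_succ]
  rw [show 2 * (k + 1) - 1 = 2 * k + 1 by omega, show 2 * k + 2 * 1 = 2 * k + 1 + 1 by omega,
    pow_succ (x / 2) (2 * k + 1), pow_succ (-1)]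
  push_cast
  field_simp

lemma jSeries_zero_eq (x : ℝ) :
    jSeries 0 x = 1 - ∑' k : ℕ, (-1) ^ k / ((k + 1).factorial : ℝ) ^ 2 * (x / 2) ^ (2 * k + 2) := by
  rw [jSeries, (summable_half_pow (abs_jCoeff_le 0) (2 * 0) x).tsum_eq_zero_add, sub_eq_add_neg,
    ← tsum_neg]
  congr 1
  · simp [jCoeff]
  · refine tsum_congr fun k => ?_
    simp only [jCoeff, zero_add]
    rw [show 2 * (k + 1) + 2 * 0 = 2 * k + 2 by omega]
    ring

lemma summable_jSeries_zero_tail (x : ℝ) : Summable fun k : ℕ =>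
    (-1 : ℝ) ^ k / ((k + 1).factorial : ℝ) ^ 2 * (x / 2) ^ (2 * k + 2) := by
  have h := ((summable_nat_add_iff 1).2 (summable_half_pow (abs_jCoeff_le 0) 0 x)).neg
  refine h.congr fun k => ?_
  simp only [jCoeff, zero_add]
  rw [show 2 * (k + 1) + 0 = 2 * k + 2 by omega]
  ring

/-- The differentiated series has no `k = 0` term, so the digamma increments give `J_0 - 1` rather
than `J_0`. The missing 1 reappears in `hasDerivAt_scaledK_zero` as the polynomial part `yPoly 1 =
1` of `𝓚_1`. -/
lemma hasDerivAt_psiSeries_zero {x : ℝ} (hx : x ≠ 0) :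
    HasDerivAt (psiSeries 0) (- (2 / x * psiSeries 1 x) + 2 / x * (jSeries 0 x - 1)) x := by
  refine (hasDerivAt_tsum_half_pow (abs_psiCoeff_le 0) (2 * 0) x).congr_deriv ?_
  rw [(summable_half_pow_deriv (abs_psiCoeff_le 0) (2 * 0) x).tsum_eq_zero_add,
    jSeries_zero_eq, sub_sub_cancel_left, mul_neg, ← neg_add, psiSeries, ← tsum_mul_left,
    ← tsum_mul_left, ← Summable.tsum_add
    ((summable_half_pow (abs_psiCoeff_le 1) _ x).mul_left _)
    ((summable_jSeries_zero_tail x).mul_left _), ← tsum_neg]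
  simp only [Nat.cast_zero, mul_zero, zero_div, add_zero, zero_mul, zero_add]
  refine tsum_congr fun k => ?_
  simp only [psiCoeff, zero_add, add_comm 1 k, Nat.factorial_succ, digammaSucc_succ]
  rw [show 2 * (k + 1) - 1 = 2 * k + 1 by omega, show 2 * k + 2 * 1 = 2 * k + 1 + 1 by omega,
    show 2 * k + 2 = 2 * k + 1 + 1 by omega, pow_succ (x / 2) (2 * k + 1), pow_succ (-1)]
  push_cast
  field_simp
  ring

lemma hasDerivAt_scaledK_zero {x : ℝ} (hx : 0 < x) :
    HasDerivAt (scaledK 0) (2 / Real.pi - scaledK 1 x / x) x := by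
  have h := ((hasDerivAt_hSeries_zero hx.ne').sub
    ((((((hasDerivAt_log_half hx).const_mul 2).mul (hasDerivAt_jSeries_zero hx.ne')).sub
      (hasDerivAt_const x (yPoly 0 x))).sub (hasDerivAt_psiSeries_zero hx.ne')).div_const
        Real.pi)).const_mul (2 ^ 0 : ℝ)
  refine (h.congr_of_eventuallyEq ?_).congr_deriv ?_
  · filter_upwards [lt_mem_nhds hx] with y hy
    rw [scaledK_eq _ hy]
    simp [yPoly]
  · rw [scaledK_eq 1 hx]
    simp [yPoly]
    field_simp
    ring

/-! ### Behaviour of `𝓚_m` at the origin -/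

lemma tendsto_hSeries (m : ℕ) : Tendsto (hSeries m) (𝓝[>] 0) (𝓝 0) := by
  have h : ContinuousAt (hSeries m) 0 :=
    (hasDerivAt_tsum_half_pow (abs_hCoeff_le m) (2 * m + 1) 0).continuousAt
  have h0 : hSeries m 0 = 0 := by simp [hSeries]
  have := h.tendsto
  rw [h0] at this
  exact this.mono_left nhdsWithin_le_nhds

lemma tendsto_psiSeries_succ (m : ℕ) : Tendsto (psiSeries (m + 1)) (𝓝[>] 0) (𝓝 0) := by
  have h : ContinuousAt (psiSeries (m + 1)) 0 :=
    (hasDerivAt_tsum_half_pow (abs_psiCoeff_le (m + 1)) (2 * (m + 1)) 0).continuousAt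
  have h0 : psiSeries (m + 1) 0 = 0 := by simp [psiSeries]
  have := h.tendsto
  rw [h0] at this
  exact this.mono_left nhdsWithin_le_nhds

lemma tendsto_psiSeries_zero :
    Tendsto (psiSeries 0) (𝓝[>] 0) (𝓝 (-2 * Real.eulerMascheroniConstant)) := by
  have h : ContinuousAt (psiSeries 0) 0 :=
    (hasDerivAt_tsum_half_pow (abs_psiCoeff_le 0) (2 * 0) 0).continuousAt
  have h0 : psiSeries 0 0 = -2 * Real.eulerMascheroniConstant := by
    rw [psiSeries, tsum_eq_single 0]
    · simp [psiCoeff, digammaSucc]; ring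
    · intro k hk; simp [hk]
  have := h.tendsto
  rw [h0] at this
  exact this.mono_left nhdsWithin_le_nhds

lemma tendsto_log_half_mul_self :
    Tendsto (fun x : ℝ => Real.log (x / 2) * x) (𝓝[>] 0) (𝓝 0) := by
  have h1 : Tendsto (fun x : ℝ => Real.log x * x) (𝓝[>] 0) (𝓝 0) := by
    simpa using tendsto_log_mul_rpow_nhdsGT_zero one_pos
  have h2 : Tendsto (fun x : ℝ => Real.log 2 * x) (𝓝[>] 0) (𝓝 0) := by
    have : Tendsto (fun x : ℝ => Real.log 2 * x) (𝓝 0) (𝓝 (Real.log 2 * 0)) :=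
      (continuous_const.mul continuous_id).tendsto 0
    rw [mul_zero] at this
    exact this.mono_left nhdsWithin_le_nhds
  have := h1.sub h2
  rw [sub_zero] at this
  refine this.congr' ?_
  filter_upwards [self_mem_nhdsWithin] with x hx
  rw [Real.log_div (ne_of_gt hx) two_ne_zero]
  ring

/-- `log(x/2) f(x) → 0` at `0+` if `f` vanishes at `0` and is differentiable there. -/
lemma tendsto_log_half_mul {f : ℝ → ℝ} {f' : ℝ} (hf : HasDerivAt f f' 0) (h0 : f 0 = 0) :
    Tendsto (fun x : ℝ => Real.log (x / 2) * f x) (𝓝[>] 0) (𝓝 0) := by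
  have h1 : Tendsto (fun x : ℝ => x⁻¹ * f x) (𝓝[>] 0) (𝓝 f') := by
    have := hf.tendsto_slope_zero_right
    simpa [h0] using this
  have := tendsto_log_half_mul_self.mul h1
  rw [zero_mul] at this
  refine this.congr' ?_
  filter_upwards [self_mem_nhdsWithin] with x hx
  have : x ≠ 0 := ne_of_gt hx
  field_simp

/-- Only the constant term `m!` of the polynomial part of `Y_{m+1}` survives, since `jSeries (m +
1)` vanishes at 0 and kills the logarithm. -/
lemma tendsto_scaledK_succ (m : ℕ) :
    Tendsto (scaledK (m + 1)) (𝓝[>] 0) (𝓝 (2 ^ (m + 1) * (m.factorial / Real.pi))) := by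
  have hJ : Tendsto (fun x : ℝ => Real.log (x / 2) * jSeries (m + 1) x) (𝓝[>] 0) (𝓝 0) :=
    tendsto_log_half_mul (hasDerivAt_jSeries_succ m 0) (by simp [jSeries])
  have hP : Tendsto (yPoly (m + 1)) (𝓝[>] 0) (𝓝 m.factorial) := by
    have h := (hasDerivAt_yPoly_succ m 0).continuousAt.tendsto
    have h0 : yPoly (m + 1) 0 = m.factorial := by
      rw [yPoly, Finset.sum_range_succ']
      simp
    rw [h0] at h
    exact h.mono_left nhdsWithin_le_nhds
  have h := ((tendsto_hSeries (m + 1)).sub ((((hJ.const_mul 2).sub hP).sub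
    (tendsto_psiSeries_succ m)).div_const Real.pi)).const_mul (2 ^ (m + 1) : ℝ)
  have e : (2 : ℝ) ^ (m + 1) * (0 - (2 * 0 - (m.factorial : ℝ) - 0) / Real.pi) =
      2 ^ (m + 1) * (m.factorial / Real.pi) := by ring
  rw [e] at h
  refine h.congr' ?_
  filter_upwards [self_mem_nhdsWithin] with x hx
  rw [scaledK_eq _ hx, mul_assoc 2]

/-- Here `J_0(0) = 1`, so the logarithm remains and has to be compensated; `J_0 - 1` absorbs the
rest of it. -/
lemma tendsto_scaledK_zero :
    Tendsto (fun x => scaledK 0 x + 2 / Real.pi * Real.log x) (𝓝[>] 0)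
      (𝓝 (2 / Real.pi * (Real.log 2 - Real.eulerMascheroniConstant))) := by
  have hJ : Tendsto (fun x : ℝ => Real.log (x / 2) * (jSeries 0 x - 1)) (𝓝[>] 0) (𝓝 0) := by
    refine tendsto_log_half_mul (f := fun x => jSeries 0 x - 1)
      ((hasDerivAt_tsum_half_pow (abs_jCoeff_le 0) (2 * 0) 0).sub_const 1) ?_
    simp [jSeries_zero_eq]
  have h := ((tendsto_hSeries 0).sub ((((hJ.const_mul 2)).sub
    tendsto_psiSeries_zero).div_const Real.pi)).add_const (2 / Real.pi * Real.log 2)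
  have e : (0 - (2 * 0 - -2 * Real.eulerMascheroniConstant) / Real.pi) + 2 / Real.pi * Real.log 2 =
      2 / Real.pi * (Real.log 2 - Real.eulerMascheroniConstant) := by ring
  rw [e] at h
  refine h.congr' ?_
  filter_upwards [self_mem_nhdsWithin] with x hx
  rw [scaledK_eq _ hx, Real.log_div (ne_of_gt hx) two_ne_zero]
  simp only [yPoly, Finset.range_zero, Finset.sum_empty]
  ring

/-! ### The Laplace integrals `G_p`: derivatives and limits at the origin -/

/-- `∫_0^∞ (x² + s²)^p e^{-s} ds`. -/
def laplaceG (p x : ℝ) : ℝ := ∫ s in Ioi (0 : ℝ), (x ^ 2 + s ^ 2) ^ p * Real.exp (-s)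

lemma continuous_sq_add_sq_rpow (p : ℝ) {x : ℝ} (hx : 0 < x) :
    Continuous fun s : ℝ => (x ^ 2 + s ^ 2) ^ p :=
  (by fun_prop : Continuous fun s : ℝ => x ^ 2 + s ^ 2).rpow_const
    fun s => Or.inl (by positivity)

lemma isBigO_sq_add_sq_rpow (p : ℝ) {x : ℝ} (hx : 0 < x) :
    (fun s : ℝ => (x ^ 2 + s ^ 2) ^ p) =O[atTop] fun s => Real.exp (1 / 2 * s) := by
  rcases le_total 0 p with hp | hp
  · have h1 : (fun s : ℝ => (x + s) ^ (2 * p)) =O[atTop] fun s => Real.exp (1 / 2 * (x + s)) :=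
      ((isLittleO_rpow_exp_pos_mul_atTop (2 * p) one_half_pos).comp_tendsto
        (tendsto_atTop_add_const_left _ x tendsto_id)).isBigO
    have h2 : (fun s : ℝ => Real.exp (1 / 2 * (x + s))) =O[atTop]
        fun s => Real.exp (1 / 2 * s) := by
      simp_rw [mul_add, Real.exp_add]
      exact Asymptotics.isBigO_const_mul_self _ _ _
    refine Asymptotics.IsBigO.trans ?_ (h1.trans h2)
    refine Asymptotics.IsBigO.of_bound 1 ?_
    filter_upwards [eventually_ge_atTop 0] with s hs
    rw [one_mul, Real.norm_of_nonneg (by positivity), Real.norm_of_nonneg (by positivity),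
      Real.rpow_mul (by positivity), Real.rpow_two]
    exact Real.rpow_le_rpow (by positivity) (by nlinarith) hp
  · refine Asymptotics.IsBigO.of_bound ((x ^ 2) ^ p) ?_
    filter_upwards [eventually_ge_atTop 0] with s hs
    rw [Real.norm_of_nonneg (by positivity), Real.norm_of_nonneg (by positivity)]
    calc (x ^ 2 + s ^ 2) ^ p ≤ (x ^ 2) ^ p :=
          Real.rpow_le_rpow_of_nonpos (by positivity) (by nlinarith [sq_nonneg s]) hp
      _ ≤ _ := le_mul_of_one_le_right (by positivity) (Real.one_le_exp (by positivity))

lemma isBigO_sq_add_sq_rpow_mul_exp (p : ℝ) {x : ℝ} (hx : 0 < x) :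
    (fun s : ℝ => (x ^ 2 + s ^ 2) ^ p * Real.exp (-s)) =O[atTop]
      fun s => Real.exp (-(1 / 2) * s) := by
  refine ((isBigO_sq_add_sq_rpow p hx).mul (Asymptotics.isBigO_refl _ _)).congr_right fun s => ?_
  rw [← Real.exp_add]; congr 1; ring

lemma integrableOn_laplaceG (p : ℝ) {x : ℝ} (hx : 0 < x) :
    IntegrableOn (fun s : ℝ => (x ^ 2 + s ^ 2) ^ p * Real.exp (-s)) (Ioi 0) :=
  integrable_of_isBigO_exp_neg one_half_pos
    ((continuous_sq_add_sq_rpow p hx).mul (by fun_prop)).continuousOn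
    (isBigO_sq_add_sq_rpow_mul_exp p hx)

lemma tendsto_exp_neg_half_mul : Tendsto (fun s : ℝ => Real.exp (-(1 / 2) * s)) atTop (𝓝 0) :=
  Real.tendsto_exp_atBot.comp (tendsto_id.const_mul_atTop_of_neg (by norm_num))

/-- A bound by the endpoint values that needs no case split on the sign of the exponent; it supplies
the dominating function in `hasDerivAt_laplaceG`. -/
lemma rpow_le_rpow_add_rpow {a y b : ℝ} (ha : 0 < a) (hay : a ≤ y) (hyb : y ≤ b) (q : ℝ) :
    y ^ q ≤ a ^ q + b ^ q := by
  rcases le_total 0 q with hq | hq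
  · have := Real.rpow_le_rpow (ha.le.trans hay) hyb hq
    have := Real.rpow_nonneg ha.le q
    linarith
  · have := Real.rpow_le_rpow_of_nonpos ha hay hq
    have := Real.rpow_nonneg (ha.le.trans (hay.trans hyb)) q
    linarith

lemma hasDerivAt_laplaceG (p : ℝ) {x : ℝ} (hx : 0 < x) :
    HasDerivAt (laplaceG p) (2 * p * x * laplaceG (p - 1) x) x := by
  have hx2 : 0 < x / 2 := by positivity
  have hx3 : 0 < 2 * x := by positivity
  have key := hasDerivAt_integral_of_dominated_loc_of_deriv_le (𝕜 := ℝ)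
    (μ := volume.restrict (Ioi (0 : ℝ)))
    (F := fun (y s : ℝ) => (y ^ 2 + s ^ 2) ^ p * Real.exp (-s))
    (F' := fun (y s : ℝ) => 2 * p * y * ((y ^ 2 + s ^ 2) ^ (p - 1) * Real.exp (-s)))
    (s := Ioo (x / 2) (2 * x)) (x₀ := x)
    (bound := fun s => |2 * p| * (2 * x) *
      (((x / 2) ^ 2 + s ^ 2) ^ (p - 1) * Real.exp (-s) +
        ((2 * x) ^ 2 + s ^ 2) ^ (p - 1) * Real.exp (-s)))
    (Ioo_mem_nhds (by linarith) (by linarith)) ?_ (integrableOn_laplaceG p hx) ?_ ?_ ?_ ?_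
  · refine key.2.congr_deriv ?_
    rw [integral_const_mul, laplaceG]
  · filter_upwards [lt_mem_nhds hx] with y hy
    exact (integrableOn_laplaceG p hy).aestronglyMeasurable
  · exact ((integrableOn_laplaceG (p - 1) hx).const_mul _).aestronglyMeasurable
  · refine ae_of_all _ fun s y hy => ?_
    have hy0 : 0 < y := hx2.trans hy.1
    have h := rpow_le_rpow_add_rpow (a := (x / 2) ^ 2 + s ^ 2) (y := y ^ 2 + s ^ 2)
      (b := (2 * x) ^ 2 + s ^ 2) (by positivity) (by nlinarith [hy.1]) (by nlinarith [hy.2]) (p - 1)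
    rw [norm_mul, norm_mul (2 * p), Real.norm_of_nonneg
      (by positivity : 0 ≤ (y ^ 2 + s ^ 2) ^ (p - 1) * Real.exp (-s)),
      Real.norm_of_nonneg hy0.le, Real.norm_eq_abs, ← add_mul]
    have := hy.2.le
    gcongr
  · exact ((integrableOn_laplaceG (p - 1) hx2).add (integrableOn_laplaceG (p - 1) hx3)).const_mul _
  · refine ae_of_all _ fun s y hy => ?_
    have hy0 : 0 < y := hx2.trans hy.1
    have h := ((((hasDerivAt_pow 2 y).add_const (s ^ 2)).rpow_const (p := p)
      (Or.inl (by positivity))).mul_const (Real.exp (-s)))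
    refine h.congr_deriv ?_
    push_cast
    ring

lemma hasDerivAt_sq_add_sq_rpow (q : ℝ) {x : ℝ} (hx : 0 < x) (s : ℝ) :
    HasDerivAt (fun s : ℝ => (x ^ 2 + s ^ 2) ^ q) (2 * q * s * (x ^ 2 + s ^ 2) ^ (q - 1)) s := by
  refine (((hasDerivAt_pow 2 s).const_add (x ^ 2)).rpow_const (p := q)
    (Or.inl (by positivity))).congr_deriv ?_
  push_cast
  ring

lemma hasDerivAt_exp_neg (s : ℝ) : HasDerivAt (fun s : ℝ => Real.exp (-s)) (-Real.exp (-s)) s := by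
  simpa using (hasDerivAt_neg s).exp

/-- With `Q = x² + s²`, the integrand `(x² Q^{-3/2} - Q^{1/2}) e^{-s}` is the exact derivative of
`(s Q^{-1/2} + Q^{1/2}) e^{-s}`, which equals `x` at `s = 0`. This expresses `G_{-1/2}'` through
`G_{1/2}`, closing the system in orders 0 and 1. -/
lemma sq_mul_laplaceG_neg_three_halves {x : ℝ} (hx : 0 < x) :
    x ^ 2 * laplaceG (-1 / 2 - 1) x = laplaceG (1 / 2) x - x := by
  have hd : ∀ s ∈ Ici (0 : ℝ), HasDerivAt
      (fun s : ℝ => (s * (x ^ 2 + s ^ 2) ^ (-1 / 2 : ℝ) + (x ^ 2 + s ^ 2) ^ (1 / 2 : ℝ)) *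
        Real.exp (-s))
      (x ^ 2 * ((x ^ 2 + s ^ 2) ^ (-1 / 2 - 1 : ℝ) * Real.exp (-s)) -
        (x ^ 2 + s ^ 2) ^ (1 / 2 : ℝ) * Real.exp (-s)) s := by
    intro s _
    refine ((((hasDerivAt_id' s).mul (hasDerivAt_sq_add_sq_rpow (-1 / 2) hx s)).add
      (hasDerivAt_sq_add_sq_rpow (1 / 2) hx s)).mul (hasDerivAt_exp_neg s)).congr_deriv ?_
    have hpos : 0 < x ^ 2 + s ^ 2 := by positivity
    have e1 : (x ^ 2 + s ^ 2) ^ (-1 / 2 : ℝ) =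
        (x ^ 2 + s ^ 2) ^ (-1 / 2 - 1 : ℝ) * (x ^ 2 + s ^ 2) := by
      rw [← Real.rpow_add_one hpos.ne']; norm_num
    have e2 : (x ^ 2 + s ^ 2) ^ (1 / 2 - 1 : ℝ) = (x ^ 2 + s ^ 2) ^ (-1 / 2 : ℝ) := by norm_num
    simp only [Pi.add_apply, Pi.mul_apply]
    rw [e2, e1]
    ring
  have hi1 := (integrableOn_laplaceG (-1 / 2 - 1) hx).const_mul (x ^ 2)
  have hi2 := integrableOn_laplaceG (1 / 2) hx
  have hlim : Tendsto (fun s : ℝ => (s * (x ^ 2 + s ^ 2) ^ (-1 / 2 : ℝ) +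
      (x ^ 2 + s ^ 2) ^ (1 / 2 : ℝ)) * Real.exp (-s)) atTop (𝓝 0) := by
    have h1 := Real.tendsto_exp_neg_atTop_nhds_zero.add
      ((isBigO_sq_add_sq_rpow_mul_exp (1 / 2) hx).trans_tendsto tendsto_exp_neg_half_mul)
    rw [add_zero] at h1
    refine squeeze_zero' ?_ ?_ h1
    · filter_upwards [eventually_ge_atTop 0] with s hs
      positivity
    · filter_upwards [eventually_ge_atTop 0] with s hs
      have hpos : 0 < x ^ 2 + s ^ 2 := by positivity
      have h2 : s ≤ (x ^ 2 + s ^ 2) ^ (1 / 2 : ℝ) := by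
        rw [← Real.sqrt_eq_rpow]; exact Real.le_sqrt_of_sq_le (by nlinarith [sq_nonneg x])
      have h3 : (x ^ 2 + s ^ 2) ^ (1 / 2 : ℝ) * (x ^ 2 + s ^ 2) ^ (-1 / 2 : ℝ) = 1 := by
        rw [← Real.rpow_add hpos]; norm_num
      have h4 : s * (x ^ 2 + s ^ 2) ^ (-1 / 2 : ℝ) ≤ 1 :=
        (mul_le_mul_of_nonneg_right h2 (by positivity)).trans_eq h3
      rw [add_mul]
      have := Real.exp_pos (-s)
      nlinarith
  have h := integral_Ioi_of_hasDerivAt_of_tendsto' hd (hi1.sub hi2) hlim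
  rw [integral_sub hi1 hi2, integral_const_mul] at h
  rw [laplaceG, laplaceG]
  have h0 : (x ^ 2) ^ (1 / 2 : ℝ) = x := by
    rw [← Real.sqrt_eq_rpow, Real.sqrt_sq hx.le]
  norm_num [h0] at h ⊢
  linarith

lemma tendsto_laplaceG_of_pos {p : ℝ} (hp : 0 < p) :
    Tendsto (laplaceG p) (𝓝[>] 0) (𝓝 (Real.Gamma (2 * p + 1))) := by
  rw [Real.Gamma_eq_integral (by positivity)]
  refine tendsto_integral_filter_of_dominated_convergence
    (fun s => (1 ^ 2 + s ^ 2) ^ p * Real.exp (-s)) ?_ ?_ (integrableOn_laplaceG p one_pos) ?_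
  · filter_upwards [self_mem_nhdsWithin] with y hy
    exact (integrableOn_laplaceG p hy).aestronglyMeasurable
  · filter_upwards [Ioo_mem_nhdsGT one_pos] with y hy
    refine ae_of_all _ fun s => ?_
    rw [Real.norm_of_nonneg (by positivity)]
    have := hy.1
    have := hy.2
    gcongr
  · refine (ae_restrict_iff' measurableSet_Ioi).2 (ae_of_all _ fun s hs => ?_)
    have hs0 : (0 : ℝ) < s := hs
    have hc : ContinuousAt (fun y : ℝ => (y ^ 2 + s ^ 2) ^ p * Real.exp (-s)) 0 := by
      refine ContinuousAt.mul (ContinuousAt.rpow_const (by fun_prop) (Or.inr hp.le))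
        continuousAt_const
    have h := hc.tendsto
    have e : ((0 : ℝ) ^ 2 + s ^ 2) ^ p * Real.exp (-s) = Real.exp (-s) * s ^ (2 * p + 1 - 1) := by
      rw [add_sub_cancel_right, Real.rpow_mul hs0.le, Real.rpow_two, zero_pow two_ne_zero, zero_add,
        mul_comm]
    rw [e] at h
    exact h.mono_left nhdsWithin_le_nhds

/-- This is `Γ'(1) = -γ`, with the derivative taken under the Gamma integral. -/
lemma integral_log_mul_exp_neg :
    ∫ s in Ioi (0 : ℝ), Real.log s * Real.exp (-s) = -Real.eulerMascheroniConstant := by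
  have h1 := Complex.hasDerivAt_GammaIntegral (s := 1) (by simp)
  have h2 : HasDerivAt Complex.GammaIntegral (-Real.eulerMascheroniConstant : ℂ) 1 := by
    refine Complex.hasDerivAt_Gamma_one.congr_of_eventuallyEq ?_
    have : IsOpen {s : ℂ | 0 < s.re} := Complex.continuous_re.isOpen_preimage _ isOpen_Ioi
    filter_upwards [this.mem_nhds (by simp : (1 : ℂ) ∈ {s : ℂ | 0 < s.re})] with a ha
    exact (Complex.Gamma_eq_integral ha).symm
  have h := h1.unique h2
  simp only [sub_self, Complex.cpow_zero, one_mul] at h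
  rw [← Complex.ofReal_inj, ← integral_complex_ofReal]
  push_cast at h ⊢
  exact h

lemma integrableOn_log_mul_exp_neg :
    IntegrableOn (fun s : ℝ => Real.log s * Real.exp (-s)) (Ioi 0) := by
  -- A non-integrable function has Bochner integral 0, whereas the value `-γ` is nonzero.
  by_contra h
  have h1 := integral_log_mul_exp_neg
  rw [integral_undef h] at h1
  linarith [Real.one_half_lt_eulerMascheroniConstant]

lemma integrableOn_exp_neg : IntegrableOn (fun s : ℝ => Real.exp (-s)) (Ioi 0) := by
  simpa using exp_neg_integrableOn_Ioi 0 one_pos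

lemma integrableOn_self_mul_exp_neg : IntegrableOn (fun s : ℝ => s * Real.exp (-s)) (Ioi 0) := by
  have := Real.GammaIntegral_convergent (s := 2) two_pos
  refine this.congr_fun (fun s _ => ?_) measurableSet_Ioi
  norm_num [mul_comm]

lemma hasDerivAt_log_add_sqrt {x : ℝ} (hx : 0 < x) {s : ℝ} (hs : 0 ≤ s) :
    HasDerivAt (fun s : ℝ => Real.log (s + √(x ^ 2 + s ^ 2))) ((x ^ 2 + s ^ 2) ^ (-1 / 2 : ℝ)) s := by
  have hpos : 0 < x ^ 2 + s ^ 2 := by positivity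
  have hr : 0 < √(x ^ 2 + s ^ 2) := Real.sqrt_pos.2 hpos
  have h := ((hasDerivAt_id' s).add (((hasDerivAt_pow 2 s).const_add (x ^ 2)).sqrt hpos.ne')).log
    (show s + √(x ^ 2 + s ^ 2) ≠ 0 by positivity)
  refine h.congr_deriv ?_
  rw [neg_div, Real.rpow_neg hpos.le, ← Real.sqrt_eq_rpow]
  simp only [Pi.add_apply]
  push_cast
  field_simp
  ring

/-- Integration by parts with the primitive `log(s + √(x² + s²))`; the boundary value `log x` at `s
= 0` isolates the logarithmic singularity. -/
lemma laplaceG_neg_half {x : ℝ} (hx : 0 < x) :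
    IntegrableOn (fun s : ℝ => Real.log (s + √(x ^ 2 + s ^ 2)) * Real.exp (-s)) (Ioi 0) ∧
    laplaceG (-1 / 2) x + Real.log x =
      ∫ s in Ioi (0 : ℝ), Real.log (s + √(x ^ 2 + s ^ 2)) * Real.exp (-s) := by
  have hb : ∀ s : ℝ, 0 ≤ s → |Real.log (s + √(x ^ 2 + s ^ 2))| ≤ |Real.log x| + x + 2 * s := by
    intro s hs
    have h1 : x ≤ √(x ^ 2 + s ^ 2) := Real.le_sqrt_of_sq_le (by nlinarith [sq_nonneg s])
    have h2 : √(x ^ 2 + s ^ 2) ≤ x + s := Real.sqrt_le_iff.2 ⟨by positivity, by nlinarith⟩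
    have h3 : Real.log x ≤ Real.log (s + √(x ^ 2 + s ^ 2)) :=
      Real.log_le_log hx (by linarith)
    have h4 := Real.log_le_sub_one_of_pos (by linarith : 0 < s + √(x ^ 2 + s ^ 2))
    rw [abs_le]
    constructor <;> linarith [neg_abs_le (Real.log x), abs_nonneg (Real.log x)]
  have hcont : ContinuousOn (fun s : ℝ => Real.log (s + √(x ^ 2 + s ^ 2)) * Real.exp (-s))
      (Ici 0) := fun s hs =>
    ((hasDerivAt_log_add_sqrt hx hs).continuousAt.mul (by fun_prop)).continuousWithinAt
  have hint : IntegrableOn (fun s : ℝ => Real.log (s + √(x ^ 2 + s ^ 2)) * Real.exp (-s))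
      (Ioi 0) := by
    refine Integrable.mono' ((integrableOn_exp_neg.const_mul (|Real.log x| + x)).add
      (integrableOn_self_mul_exp_neg.const_mul 2))
      ((hcont.mono Ioi_subset_Ici_self).aestronglyMeasurable measurableSet_Ioi) ?_
    refine (ae_restrict_iff' measurableSet_Ioi).2 (ae_of_all _ fun s hs => ?_)
    rw [norm_mul, Real.norm_of_nonneg (Real.exp_pos _).le, Real.norm_eq_abs]
    calc _ ≤ (|Real.log x| + x + 2 * s) * Real.exp (-s) := by
          gcongr; exact hb s (le_of_lt hs)
      _ = _ := by simp only [Pi.add_apply]; ring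
  refine ⟨hint, ?_⟩
  have hd : ∀ s ∈ Ici (0 : ℝ), HasDerivAt
      (fun s : ℝ => Real.log (s + √(x ^ 2 + s ^ 2)) * Real.exp (-s))
      ((x ^ 2 + s ^ 2) ^ (-1 / 2 : ℝ) * Real.exp (-s) -
        Real.log (s + √(x ^ 2 + s ^ 2)) * Real.exp (-s)) s := by
    intro s hs
    refine ((hasDerivAt_log_add_sqrt hx hs).mul (hasDerivAt_exp_neg s)).congr_deriv ?_
    ring
  have hlim : Tendsto (fun s : ℝ => Real.log (s + √(x ^ 2 + s ^ 2)) * Real.exp (-s))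
      atTop (𝓝 0) := by
    have h1 : Tendsto (fun s : ℝ => (|Real.log x| + x) * Real.exp (-s) +
        2 * (s ^ 1 * Real.exp (-s))) atTop (𝓝 ((|Real.log x| + x) * 0 + 2 * 0)) :=
      (Real.tendsto_exp_neg_atTop_nhds_zero.const_mul _).add
        ((Real.tendsto_pow_mul_exp_neg_atTop_nhds_zero 1).const_mul 2)
    rw [mul_zero, mul_zero, add_zero] at h1
    refine squeeze_zero_norm' ?_ h1
    filter_upwards [eventually_ge_atTop 0] with s hs
    rw [norm_mul, Real.norm_of_nonneg (Real.exp_pos _).le, Real.norm_eq_abs]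
    calc _ ≤ (|Real.log x| + x + 2 * s) * Real.exp (-s) := by
          gcongr; exact hb s hs
      _ = _ := by ring
  have hi := integrableOn_laplaceG (-1 / 2) hx
  have h := integral_Ioi_of_hasDerivAt_of_tendsto' hd (hi.sub hint) hlim
  rw [integral_sub hi hint] at h
  rw [laplaceG]
  have h0 : √(x ^ 2) = x := Real.sqrt_sq hx.le
  norm_num [h0] at h ⊢
  linarith

/-- As `x → 0+` the integral from `laplaceG_neg_half` tends to `∫ log(2s) e^{-s} ds`, the same
constant as for `𝓚_0` up to the factor `2/π`. -/
lemma tendsto_laplaceG_neg_half :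
    Tendsto (fun x => laplaceG (-1 / 2) x + Real.log x) (𝓝[>] 0)
      (𝓝 (Real.log 2 - Real.eulerMascheroniConstant)) := by
  have hval : ∫ s in Ioi (0 : ℝ), Real.log (2 * s) * Real.exp (-s) =
      Real.log 2 - Real.eulerMascheroniConstant := by
    have : ∫ s in Ioi (0 : ℝ), Real.log (2 * s) * Real.exp (-s) =
        ∫ s in Ioi (0 : ℝ), (Real.log 2 * Real.exp (-s) + Real.log s * Real.exp (-s)) := by
      refine setIntegral_congr_fun measurableSet_Ioi fun s hs => ?_
      rw [Real.log_mul two_ne_zero (ne_of_gt hs)]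
      ring
    rw [this, integral_add (integrableOn_exp_neg.const_mul _) integrableOn_log_mul_exp_neg,
      integral_const_mul, integral_exp_neg_Ioi_zero, integral_log_mul_exp_neg]
    ring
  rw [← hval]
  have key : Tendsto (fun x : ℝ => ∫ s in Ioi (0 : ℝ),
      Real.log (s + √(x ^ 2 + s ^ 2)) * Real.exp (-s)) (𝓝[>] 0)
      (𝓝 (∫ s in Ioi (0 : ℝ), Real.log (2 * s) * Real.exp (-s))) := by
    refine tendsto_integral_filter_of_dominated_convergence
      (fun s => ‖Real.log s * Real.exp (-s)‖ + (1 * Real.exp (-s) + 2 * (s * Real.exp (-s)))) ?_ ?_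
      (integrableOn_log_mul_exp_neg.norm.add ((integrableOn_exp_neg.const_mul 1).add
        (integrableOn_self_mul_exp_neg.const_mul 2))) ?_
    · filter_upwards [self_mem_nhdsWithin] with y hy
      exact (laplaceG_neg_half hy).1.aestronglyMeasurable
    · filter_upwards [Ioo_mem_nhdsGT one_pos] with y hy
      refine (ae_restrict_iff' measurableSet_Ioi).2 (ae_of_all _ fun s hs => ?_)
      have hs0 : (0 : ℝ) < s := hs
      have hy0 := hy.1
      have hy1 := hy.2
      have h1 : s ≤ √(y ^ 2 + s ^ 2) := Real.le_sqrt_of_sq_le (by nlinarith [sq_nonneg y])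
      have h2 : √(y ^ 2 + s ^ 2) ≤ y + s := Real.sqrt_le_iff.2 ⟨by positivity, by nlinarith⟩
      have h3 : Real.log s ≤ Real.log (s + √(y ^ 2 + s ^ 2)) :=
        Real.log_le_log hs0 (by linarith)
      have h4 := Real.log_le_sub_one_of_pos (by linarith : 0 < s + √(y ^ 2 + s ^ 2))
      have h5 : |Real.log (s + √(y ^ 2 + s ^ 2))| ≤ |Real.log s| + 1 + 2 * s := by
        rw [abs_le]
        constructor <;> linarith [neg_abs_le (Real.log s), abs_nonneg (Real.log s)]
      rw [norm_mul, norm_mul, Real.norm_of_nonneg (Real.exp_pos _).le, Real.norm_eq_abs,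
        Real.norm_eq_abs]
      calc _ ≤ (|Real.log s| + 1 + 2 * s) * Real.exp (-s) := by gcongr
        _ = _ := by ring
    · refine (ae_restrict_iff' measurableSet_Ioi).2 (ae_of_all _ fun s hs => ?_)
      have hs0 : (0 : ℝ) < s := hs
      have hc : ContinuousAt (fun y : ℝ => Real.log (s + √(y ^ 2 + s ^ 2)) * Real.exp (-s)) 0 := by
        refine ContinuousAt.mul (ContinuousAt.log (by fun_prop) ?_) continuousAt_const
        positivity
      have h := hc.tendsto
      have e : s + √((0 : ℝ) ^ 2 + s ^ 2) = 2 * s := by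
        rw [zero_pow two_ne_zero, zero_add, Real.sqrt_sq hs0.le]; ring
      rw [e] at h
      exact h.mono_left nhdsWithin_le_nhds
  refine key.congr' ?_
  filter_upwards [self_mem_nhdsWithin] with x hx
  exact (laplaceG_neg_half hx).2.symm

/-! ### Uniqueness at the origin and the Laplace representation of `𝓚_m` -/

lemma nonpos_of_hasDerivAt_nonpos {D D' : ℝ → ℝ} (h : ∀ x, 0 < x → HasDerivAt D (D' x) x)
    (h' : ∀ x, 0 < x → D' x ≤ 0) (ht : Tendsto D (𝓝[>] 0) (𝓝 0)) {x : ℝ} (hx : 0 < x) :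
    D x ≤ 0 := by
  have hanti : AntitoneOn D (Ioi 0) := by
    refine antitoneOn_of_deriv_nonpos (convex_Ioi 0)
      (fun y hy => (h y hy).continuousAt.continuousWithinAt) ?_ ?_ <;> rw [interior_Ioi]
    · exact fun y hy => (h y hy).differentiableAt.differentiableWithinAt
    · intro y hy
      rw [(h y hy).deriv]
      exact h' y hy
  refine ge_of_tendsto ht ?_
  filter_upwards [Ioo_mem_nhdsGT hx] with y hy
  exact hanti hy.1 hx hy.2.le

lemma eq_zero_of_hasDerivAt_zero {D : ℝ → ℝ} (h : ∀ x, 0 < x → HasDerivAt D 0 x)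
    (ht : Tendsto D (𝓝[>] 0) (𝓝 0)) {x : ℝ} (hx : 0 < x) : D x = 0 := by
  refine le_antisymm (nonpos_of_hasDerivAt_nonpos h (fun _ _ => le_rfl) ht hx) ?_
  have := nonpos_of_hasDerivAt_nonpos (D := fun x => -D x) (D' := fun _ => 0)
    (fun x hx => (h x hx).neg.congr_deriv neg_zero) (fun _ _ => le_rfl) (by simpa using ht.neg) hx
  linarith

/-- Uniqueness for Bessel's equation of order zero at the origin, as a first order system. -/
lemma eq_zero_of_bessel_system {A B : ℝ → ℝ} (hA : ∀ x, 0 < x → HasDerivAt A (-(B x / x)) x)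
    (hB : ∀ x, 0 < x → HasDerivAt B (x * A x) x) (hA0 : Tendsto A (𝓝[>] 0) (𝓝 0))
    (hB0 : Tendsto B (𝓝[>] 0) (𝓝 0)) {x : ℝ} (hx : 0 < x) : A x = 0 := by
  have hid : Tendsto (fun x : ℝ => x) (𝓝[>] 0) (𝓝 0) := tendsto_id.mono_left nhdsWithin_le_nhds
  have hBx : Tendsto (fun x => B x / x) (𝓝[>] 0) (𝓝 0) := by
    refine HasDerivAt.lhopital_zero_nhdsGT (f' := fun x => x * A x) (g' := fun _ => 1)
      ?_ ?_ ?_ hB0 hid ?_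
    · filter_upwards [self_mem_nhdsWithin] with y hy using hB y hy
    · exact Eventually.of_forall fun y => hasDerivAt_id' y
    · exact Eventually.of_forall fun y => one_ne_zero
    · simpa using hid.mul hA0
  -- The energy `A² + (B/y)²` is nonincreasing: its cross terms cancel. It starts from 0, the limit
  -- of `B/y` coming from l'Hôpital's rule.
  have hE : ∀ y, 0 < y → HasDerivAt (fun y => A y ^ 2 + (B y / y) ^ 2)
      (-2 * (B y ^ 2 / y ^ 3)) y := by
    intro y hy
    refine (((hA y hy).pow 2).add (((hB y hy).div (hasDerivAt_id' y) hy.ne').pow 2)).congr_deriv ?_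
    have hy0 : y ≠ 0 := hy.ne'
    simp only [Pi.div_apply]
    norm_num
    field_simp
    ring
  have hE0 : Tendsto (fun y => A y ^ 2 + (B y / y) ^ 2) (𝓝[>] 0) (𝓝 0) := by
    simpa using (hA0.pow 2).add (hBx.pow 2)
  have := nonpos_of_hasDerivAt_nonpos hE (fun y hy => by
    have : 0 ≤ B y ^ 2 / y ^ 3 := by positivity
    linarith) hE0 hx
  have h2 : A x ^ 2 = 0 := le_antisymm (by nlinarith [sq_nonneg (B x / x)]) (sq_nonneg _)
  simpa using h2

lemma poch_succ (a : ℝ) (m : ℕ) : poch a (m + 1) = poch a m * (a + m) := by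
  rw [poch, poch, ascPochhammer_succ_eval]

lemma poch_zero (a : ℝ) : poch a 0 = 1 := by simp [poch]

/-- A form of the duplication formula, needed to match `Γ(2m + 2)` with the limit of `𝓚_{m+1}` at 0.
-/
lemma four_pow_mul_poch_half (m : ℕ) :
    4 ^ (m + 1) * poch (1 / 2) (m + 1) * m.factorial = 2 * ((2 * m + 1).factorial : ℝ) := by
  induction m with
  | zero => simp [poch_succ, poch_zero]; norm_num
  | succ m ih =>
    rw [poch_succ, pow_succ, Nat.factorial_succ, show 2 * (m + 1) + 1 = 2 * m + 1 + 1 + 1 by ring,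
      Nat.factorial_succ (2 * m + 1 + 1), Nat.factorial_succ (2 * m + 1)]
    push_cast
    linear_combination (4 * (1 / 2 + ((m : ℝ) + 1)) * (m + 1)) * ih

lemma laplaceG_neg_half_eq_scaledK {x : ℝ} (hx : 0 < x) :
    2 / Real.pi * laplaceG (-1 / 2) x - scaledK 0 x = 0 := by
  refine eq_zero_of_bessel_system (A := fun x => 2 / Real.pi * laplaceG (-1 / 2) x - scaledK 0 x)
    (B := fun x => 2 / Real.pi * laplaceG (1 / 2) x - scaledK 1 x) ?_ ?_ ?_ ?_ hx
  · intro y hy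
    refine (((hasDerivAt_laplaceG (-1 / 2) hy).const_mul (2 / Real.pi)).sub
      (hasDerivAt_scaledK_zero hy)).congr_deriv ?_
    have h := sq_mul_laplaceG_neg_three_halves hy
    have h2 : laplaceG (1 / 2) y = y ^ 2 * laplaceG (-1 / 2 - 1) y + y := by linarith
    rw [h2]
    field_simp
    ring
  · intro y hy
    refine (((hasDerivAt_laplaceG (1 / 2) hy).const_mul (2 / Real.pi)).sub
      (hasDerivAt_scaledK_succ 0 hy)).congr_deriv ?_
    rw [show (1 / 2 - 1 : ℝ) = -1 / 2 by norm_num]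
    ring
  · have h := (tendsto_laplaceG_neg_half.const_mul (2 / Real.pi)).sub tendsto_scaledK_zero
    rw [sub_self] at h
    refine h.congr fun y => ?_
    ring
  · have h := ((tendsto_laplaceG_of_pos one_half_pos).const_mul (2 / Real.pi)).sub
      (tendsto_scaledK_succ 0)
    have e : 2 / Real.pi * Real.Gamma (2 * (1 / 2) + 1) -
        2 ^ (0 + 1) * ((Nat.factorial 0 : ℝ) / Real.pi) = 0 := by
      norm_num [Real.Gamma_two]
      ring
    rw [e] at h
    exact h

/-- `𝐊_m` as a Laplace-type integral. -/
lemma laplaceG_eq_scaledK (m : ℕ) {x : ℝ} (hx : 0 < x) :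
    2 / Real.pi * laplaceG (m - 1 / 2) x = 2 ^ m * poch (1 / 2) m * scaledK m x := by
  induction m generalizing x with
  | zero =>
    have := laplaceG_neg_half_eq_scaledK hx
    rw [poch_zero, Nat.cast_zero, show (0 - 1 / 2 : ℝ) = -1 / 2 by norm_num]
    linarith
  | succ m ih =>
    have h := eq_zero_of_hasDerivAt_zero (D := fun x => 2 / Real.pi * laplaceG (m + 1 / 2) x -
      2 ^ (m + 1) * poch (1 / 2) (m + 1) * scaledK (m + 1) x) ?_ ?_ hx
    · rw [show ((m + 1 : ℕ) : ℝ) - 1 / 2 = m + 1 / 2 by push_cast; ring]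
      linarith
    · intro y hy
      refine (((hasDerivAt_laplaceG (m + 1 / 2) hy).const_mul (2 / Real.pi)).sub
        ((hasDerivAt_scaledK_succ m hy).const_mul _)).congr_deriv ?_
      rw [show (m : ℝ) + 1 / 2 - 1 = m - 1 / 2 by ring, poch_succ]
      linear_combination ((2 * m + 1) * y) * ih hy
    · have h := ((tendsto_laplaceG_of_pos (p := m + 1 / 2) (by positivity)).const_mul
        (2 / Real.pi)).sub ((tendsto_scaledK_succ m).const_mul
          (2 ^ (m + 1) * poch (1 / 2) (m + 1)))
      have e : 2 / Real.pi * Real.Gamma (2 * (m + 1 / 2) + 1) - 2 ^ (m + 1) * poch (1 / 2) (m + 1) *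
          (2 ^ (m + 1) * ((m.factorial : ℝ) / Real.pi)) = 0 := by
        have e1 : Real.Gamma (2 * (m + 1 / 2) + 1) = (2 * m + 1).factorial := by
          rw [← Real.Gamma_nat_eq_factorial]; push_cast; congr 1; ring
        have e2 := four_pow_mul_poch_half m
        have e3 : (4 : ℝ) ^ (m + 1) = 2 ^ (m + 1) * 2 ^ (m + 1) := by rw [← mul_pow]; norm_num
        rw [e3] at e2
        rw [e1]
        linear_combination (-1 / Real.pi) * e2
      rw [e] at h
      exact h

/-! ### The integrals `C_m` and their recurrence -/

lemma integrableOn_pow_mul_exp_neg_mul (n : ℕ) {x : ℝ} (hx : 0 < x) :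
    IntegrableOn (fun ξ : ℝ => ξ ^ n * Real.exp (-x * ξ)) (Ioi 0) := by
  have h := integrableOn_rpow_mul_exp_neg_mul_rpow (s := n) (p := 1) (b := x)
    (by linarith [n.cast_nonneg (α := ℝ)]) one_pos hx
  refine h.congr_fun (fun ξ _ => ?_) measurableSet_Ioi
  simp only [Real.rpow_natCast, Real.rpow_one]

lemma one_le_sqrt_one_add_sq (ξ : ℝ) : 1 ≤ √(1 + ξ ^ 2) :=
  Real.le_sqrt_of_sq_le (by nlinarith [sq_nonneg ξ])

lemma continuous_coeffIntegrand (m : ℕ) (x : ℝ) : Continuous (coeffIntegrand m x) := by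
  unfold coeffIntegrand
  refine Continuous.div (by fun_prop) (by fun_prop) fun ξ => ?_
  linarith [one_le_sqrt_one_add_sq ξ]

lemma integrableOn_coeffIntegrand (m : ℕ) {x : ℝ} (hx : 0 < x) :
    IntegrableOn (coeffIntegrand m x) (Ioi 0) := by
  refine Integrable.mono' (integrableOn_pow_mul_exp_neg_mul (2 * m) hx)
    (continuous_coeffIntegrand m x).aestronglyMeasurable
    ((ae_restrict_iff' measurableSet_Ioi).2 (ae_of_all _ fun ξ hξ => ?_))
  have hξ0 : (0 : ℝ) < ξ := hξ
  rw [coeffIntegrand, Real.norm_of_nonneg (by positivity)]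
  exact div_le_self (by positivity) (one_le_sqrt_one_add_sq ξ)

lemma sum_choose_mul_coeffC (m : ℕ) {x : ℝ} (hx : 0 < x) :
    ∑ r ∈ Finset.range (m + 1), (m.choose r : ℝ) * x ^ (2 * (m - r)) * coeffC r x =
      2 / Real.pi * laplaceG (m - 1 / 2) x := by
  have h := integral_comp_mul_left_Ioi'
    (fun s : ℝ => (x ^ 2 + s ^ 2) ^ ((m : ℝ) - 1 / 2) * Real.exp (-s)) 0 hx
  rw [mul_zero] at h
  rw [laplaceG, ← h, smul_eq_mul, ← integral_const_mul, ← integral_const_mul]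
  have e : ∀ r ∈ Finset.range (m + 1), (m.choose r : ℝ) * x ^ (2 * (m - r)) * coeffC r x =
      ∫ ξ in Ioi (0 : ℝ), 2 / Real.pi * x ^ (2 * m) * (m.choose r * coeffIntegrand r x ξ) := by
    intro r hr
    have hr' : r ≤ m := Nat.lt_succ_iff.1 (Finset.mem_range.1 hr)
    rw [coeffC, integral_const_mul, integral_const_mul,
      show 2 * m = 2 * (m - r) + 2 * r by omega, pow_add]
    ring
  rw [Finset.sum_congr rfl e, ← integral_finsetSum _ fun r _ =>
    (((integrableOn_coeffIntegrand r hx).const_mul _).const_mul _)]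
  refine setIntegral_congr_fun measurableSet_Ioi fun ξ hξ => ?_
  have hpos : (0 : ℝ) < 1 + ξ ^ 2 := by positivity
  rw [← Finset.mul_sum, show x ^ 2 + (x * ξ) ^ 2 = x ^ 2 * (1 + ξ ^ 2) by ring,
    Real.mul_rpow (by positivity) hpos.le, Real.rpow_sub (by positivity), Real.rpow_sub hpos,
    Real.rpow_natCast, Real.rpow_natCast, ← Real.sqrt_eq_rpow, ← Real.sqrt_eq_rpow,
    Real.sqrt_sq hx.le, add_comm (1 : ℝ) (ξ ^ 2), add_pow]
  simp only [coeffIntegrand, one_pow, mul_one, Finset.sum_div, Finset.mul_sum, Finset.sum_mul]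
  refine Finset.sum_congr rfl fun r _ => ?_
  rw [add_comm (ξ ^ 2), ← pow_mul, ← pow_mul, neg_mul]
  field_simp

lemma coeffC_recurrence (m : ℕ) {x : ℝ} (hx : 0 < x) :
    coeffC m x = 2 ^ m * poch (1 / 2) m * scaledK m x -
      ∑ r ∈ Finset.range m, (m.choose r : ℝ) * x ^ (2 * (m - r)) * coeffC r x := by
  have h := sum_choose_mul_coeffC m hx
  rw [laplaceG_eq_scaledK m hx, Finset.sum_range_succ] at h
  simp only [Nat.choose_self, Nat.sub_self, mul_zero, pow_zero, Nat.cast_one, one_mul] at h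
  linarith

/-! ### Poisson's integral and the Struve series -/

/-- A Beta integral, by induction on `k` for all `r` at once: splitting off one factor `1 - s²`
lowers `k` and produces `r + 1`. -/
lemma integral_pow_mul_one_sub_sq_pow (r k : ℕ) :
    ∫ s in (0 : ℝ)..1, s ^ (2 * r) * (1 - s ^ 2) ^ k =
      Real.Gamma (r + 1 / 2) * k.factorial / (2 * Real.Gamma (r + k + 3 / 2)) := by
  induction k generalizing r with
  | zero =>
    have hG : Real.Gamma ((r : ℝ) + 3 / 2) = (r + 1 / 2) * Real.Gamma (r + 1 / 2) := by
      rw [← Real.Gamma_add_one (by positivity)]; congr 1; ring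
    have h0 : Real.Gamma ((r : ℝ) + 1 / 2) ≠ 0 := (Real.Gamma_pos_of_pos (by positivity)).ne'
    simp only [pow_zero, mul_one, integral_pow, Nat.cast_zero, add_zero, hG, Nat.factorial_zero,
      Nat.cast_one]
    push_cast
    rw [one_pow, zero_pow (by omega)]
    field_simp
    ring
  | succ k ih =>
    have hG1 : Real.Gamma ((r : ℝ) + 1 + 1 / 2) = (r + 1 / 2) * Real.Gamma (r + 1 / 2) := by
      rw [← Real.Gamma_add_one (by positivity)]; congr 1; ring
    have hG2 : Real.Gamma ((r : ℝ) + 1 + k + 3 / 2) =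
        (r + k + 3 / 2) * Real.Gamma (r + k + 3 / 2) := by
      rw [← Real.Gamma_add_one (by positivity)]; congr 1; ring
    have h0 : Real.Gamma ((r : ℝ) + k + 3 / 2) ≠ 0 := (Real.Gamma_pos_of_pos (by positivity)).ne'
    have e : ∀ s : ℝ, s ^ (2 * r) * (1 - s ^ 2) ^ (k + 1) =
        s ^ (2 * r) * (1 - s ^ 2) ^ k - s ^ (2 * (r + 1)) * (1 - s ^ 2) ^ k := by
      intro s; ring
    simp_rw [e]
    rw [intervalIntegral.integral_sub (Continuous.intervalIntegrable (by fun_prop) _ _)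
      (Continuous.intervalIntegrable (by fun_prop) _ _), ih r, ih (r + 1)]
    push_cast
    rw [hG1, hG2, show (r : ℝ) + (k + 1) + 3 / 2 = r + 1 + k + 3 / 2 by ring, hG2,
      Nat.factorial_succ]
    push_cast
    field_simp
    ring

lemma poch_half_eq_Gamma (r : ℕ) : poch (1 / 2) r * √Real.pi = Real.Gamma (r + 1 / 2) := by
  induction r with
  | zero => rw [poch_zero, Nat.cast_zero, zero_add, Real.Gamma_one_half_eq, one_mul]
  | succ r ih =>
    rw [poch_succ, Nat.cast_succ, show (r : ℝ) + 1 + 1 / 2 = r + 1 / 2 + 1 by ring,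
      Real.Gamma_add_one (by positivity), ← ih]
    ring

lemma factorial_odd_eq_Gamma (k : ℕ) : ((2 * k + 1).factorial : ℝ) * √Real.pi =
    2 ^ (2 * k + 1) * k.factorial * Real.Gamma (k + 3 / 2) := by
  induction k with
  | zero =>
    have : Real.Gamma (3 / 2) = √Real.pi / 2 := by
      rw [show (3 / 2 : ℝ) = 1 / 2 + 1 by norm_num, Real.Gamma_add_one (by norm_num),
        Real.Gamma_one_half_eq]
      ring
    simp only [mul_zero, zero_add, Nat.factorial_one, Nat.cast_one, Nat.factorial_zero, pow_one,
      Nat.cast_zero, this]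
    ring
  | succ k ih =>
    rw [Nat.cast_succ, Gamma_half_step, show 2 * (k + 1) + 1 = 2 * k + 1 + 1 + 1 by ring,
      Nat.factorial_succ (2 * k + 1 + 1), Nat.factorial_succ (2 * k + 1), Nat.factorial_succ k]
    push_cast
    rw [pow_succ, pow_succ]
    linear_combination ((2 * (k : ℝ) + 1 + 1 + 1) * (2 * k + 1 + 1)) * ih

lemma scaledStruve_eq_tsum (r : ℕ) {x : ℝ} (hx : 0 < x) :
    scaledStruve r x = ∑' k : ℕ, (-1) ^ k * (x / 2) ^ (2 * k + 1) /
      (Real.Gamma (k + 3 / 2) * Real.Gamma (r + k + 3 / 2)) := by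
  have hx2 : 0 < x / 2 := by positivity
  rw [scaledStruve, struveH, ← tsum_mul_left]
  refine tsum_congr fun k => ?_
  rw [show (2 * (k : ℝ) + r + 1) = ((2 * k + 1 : ℕ) : ℝ) + r by push_cast; ring,
    Real.rpow_add hx2, Real.rpow_natCast, Real.rpow_neg hx2.le, add_comm (k : ℝ) r]
  have : (x / 2) ^ (r : ℝ) ≠ 0 := (Real.rpow_pos_of_pos hx2 _).ne'
  field_simp

/-- Poisson's integral for the scaled Struve function. -/
lemma poch_mul_scaledStruve (r : ℕ) {x : ℝ} (hx : 0 < x) :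
    poch (1 / 2) r * scaledStruve r x =
      2 / Real.pi * ∫ b in (0 : ℝ)..(Real.pi / 2), Real.sin b ^ (2 * r) *
        Real.sin (x * Real.cos b) := by
  have h : HasSum (fun k : ℕ => ∫ b in (0 : ℝ)..(Real.pi / 2), Real.sin b ^ (2 * r) *
      ((-1) ^ k * (x * Real.cos b) ^ (2 * k + 1) / (2 * k + 1).factorial))
      (∫ b in (0 : ℝ)..(Real.pi / 2), Real.sin b ^ (2 * r) * Real.sin (x * Real.cos b)) := by
    refine intervalIntegral.hasSum_integral_of_dominated_convergence
      (fun k _ => x ^ (2 * k + 1) / (2 * k + 1).factorial) ?_ ?_ ?_ ?_ ?_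
    · intro k
      exact Continuous.aestronglyMeasurable (by fun_prop)
    · intro k
      refine ae_of_all _ fun b _ => ?_
      rw [norm_mul, norm_div, norm_mul, norm_pow, norm_pow, norm_pow, norm_neg, norm_one, one_pow,
        one_mul, norm_mul, Real.norm_of_nonneg hx.le, Real.norm_natCast, Real.norm_eq_abs,
        Real.norm_eq_abs]
      have h1 : |Real.sin b| ^ (2 * r) ≤ 1 := pow_le_one₀ (abs_nonneg _) (Real.abs_sin_le_one b)
      have h2 : (x * |Real.cos b|) ^ (2 * k + 1) ≤ x ^ (2 * k + 1) := by
        refine pow_le_pow_left₀ (by positivity) ?_ _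
        exact mul_le_of_le_one_right hx.le (Real.abs_cos_le_one b)
      calc _ ≤ 1 * (x ^ (2 * k + 1) / (2 * k + 1).factorial) := by gcongr
        _ = _ := one_mul _
    · refine ae_of_all _ fun b _ => ?_
      exact (Real.hasSum_sinh x).summable
    · exact intervalIntegrable_const
    · exact ae_of_all _ fun b _ => (Real.hasSum_sin _).mul_left _
  rw [← h.tsum_eq, scaledStruve_eq_tsum r hx, ← tsum_mul_left, ← tsum_mul_left]
  refine tsum_congr fun k => ?_
  have e : ∀ b : ℝ, Real.sin b ^ (2 * r) *
      ((-1) ^ k * (x * Real.cos b) ^ (2 * k + 1) / ((2 * k + 1).factorial : ℝ)) =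
      (-1) ^ k * x ^ (2 * k + 1) / ((2 * k + 1).factorial : ℝ) *
        (Real.sin b ^ (2 * r) * Real.cos b ^ (2 * k + 1)) := by
    intro b; rw [mul_pow]; ring
  simp_rw [e]
  -- The odd power of the cosine permits the substitution `s = sin b`, which leads to the Beta
  -- integral.
  rw [intervalIntegral.integral_const_mul, integral_sin_pow_mul_cos_pow_odd, Real.sin_zero,
    Real.sin_pi_div_two, integral_pow_mul_one_sub_sq_pow, ← poch_half_eq_Gamma]
  have hf := factorial_odd_eq_Gamma k
  have hs : √Real.pi ≠ 0 := (Real.sqrt_pos.2 Real.pi_pos).ne'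
  have hf' : ((2 * k + 1).factorial : ℝ) =
      2 ^ (2 * k + 1) * k.factorial * Real.Gamma (k + 3 / 2) / √Real.pi := by
    rw [← hf]; field_simp
  have h1 : Real.Gamma ((k : ℝ) + 3 / 2) ≠ 0 := (Real.Gamma_pos_of_pos (by positivity)).ne'
  have h2 : Real.Gamma ((r : ℝ) + k + 3 / 2) ≠ 0 := (Real.Gamma_pos_of_pos (by positivity)).ne'
  rw [hf', div_pow]
  field_simp
  rw [Real.sq_sqrt Real.pi_pos.le]

/-- Poisson's integral carries `sin^{2r} b`, so the sum over `r` is the exponential series of `ρ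
sin² b` under the integral sign. -/
lemma hasSum_struveTerm {x : ℝ} (hx : 0 < x) (ρ : ℝ) :
    HasSum (struveTerm x ρ) (2 / Real.pi * ∫ b in (0 : ℝ)..(Real.pi / 2),
      Real.exp (ρ * Real.sin b ^ 2) * Real.sin (x * Real.cos b)) := by
  have h : HasSum (fun r : ℕ => ∫ b in (0 : ℝ)..(Real.pi / 2),
      (ρ * Real.sin b ^ 2) ^ r / r.factorial * Real.sin (x * Real.cos b))
      (∫ b in (0 : ℝ)..(Real.pi / 2),
        Real.exp (ρ * Real.sin b ^ 2) * Real.sin (x * Real.cos b)) := by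
    refine intervalIntegral.hasSum_integral_of_dominated_convergence
      (fun r _ => |ρ| ^ r / r.factorial) ?_ ?_ ?_ ?_ ?_
    · intro k
      exact Continuous.aestronglyMeasurable (by fun_prop)
    · intro r
      refine ae_of_all _ fun b _ => ?_
      rw [norm_mul, norm_div, norm_pow, norm_mul, Real.norm_natCast, norm_pow, Real.norm_eq_abs,
        Real.norm_eq_abs, Real.norm_eq_abs]
      have h1 : |Real.sin b| ^ 2 ≤ 1 := pow_le_one₀ (abs_nonneg _) (Real.abs_sin_le_one b)
      have h2 : (|ρ| * |Real.sin b| ^ 2) ^ r ≤ |ρ| ^ r :=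
        pow_le_pow_left₀ (by positivity) (mul_le_of_le_one_right (abs_nonneg _) h1) _
      calc _ ≤ |ρ| ^ r / r.factorial * 1 := by
            gcongr
            exact Real.abs_sin_le_one _
        _ = _ := mul_one _
    · exact ae_of_all _ fun b _ => Real.summable_pow_div_factorial _
    · exact intervalIntegrable_const
    · refine ae_of_all _ fun b _ => HasSum.mul_right _ ?_
      rw [Real.exp_eq_exp_ℝ]
      exact NormedSpace.expSeries_div_hasSum_exp _
  refine (h.mul_left (2 / Real.pi)).congr_fun fun r => ?_
  have e : ∀ b : ℝ, (ρ * Real.sin b ^ 2) ^ r / (r.factorial : ℝ) * Real.sin (x * Real.cos b) =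
      ρ ^ r / r.factorial * (Real.sin b ^ (2 * r) * Real.sin (x * Real.cos b)) := by
    intro b; rw [mul_pow, ← pow_mul]; ring
  simp_rw [e]
  rw [intervalIntegral.integral_const_mul, struveTerm]
  linear_combination (ρ ^ r / r.factorial) * poch_mul_scaledStruve r hx

/-! ### Cauchy's theorem on the rectangle -/

/-- `exp(-ρ cosh² u + i x cosh u)`. -/
def waveExp (x ρ : ℝ) (u : ℂ) : ℂ :=
  Complex.exp (-(ρ : ℂ) * Complex.cosh u ^ 2 + Complex.I * x * Complex.cosh u)

lemma differentiable_waveExp (x ρ : ℝ) : Differentiable ℂ (waveExp x ρ) := by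
  unfold waveExp
  fun_prop

lemma waveExp_ofReal_re (x ρ t : ℝ) :
    (waveExp x ρ t).re = Real.exp (-ρ * Real.cosh t ^ 2) * Real.cos (x * Real.cosh t) := by
  have : -(ρ : ℂ) * Complex.cosh t ^ 2 + Complex.I * x * Complex.cosh t =
      ((-ρ * Real.cosh t ^ 2 : ℝ) : ℂ) + ((x * Real.cosh t : ℝ) : ℂ) * Complex.I := by
    push_cast; ring
  rw [waveExp, this, Complex.exp_re]
  simp only [Complex.add_re, Complex.add_im, Complex.ofReal_re, Complex.ofReal_im,
    Complex.re_ofReal_mul, Complex.im_ofReal_mul, Complex.I_re, Complex.I_im, mul_zero, mul_one,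
    add_zero, zero_add]

lemma waveExp_mul_I_im (x ρ b : ℝ) :
    (waveExp x ρ (b * Complex.I)).im =
      Real.exp (-ρ * Real.cos b ^ 2) * Real.sin (x * Real.cos b) := by
  have : -(ρ : ℂ) * Complex.cosh (b * Complex.I) ^ 2 +
      Complex.I * x * Complex.cosh (b * Complex.I) =
      ((-ρ * Real.cos b ^ 2 : ℝ) : ℂ) + ((x * Real.cos b : ℝ) : ℂ) * Complex.I := by
    rw [Complex.cosh_mul_I]; push_cast; ring
  rw [waveExp, this, Complex.exp_im]
  simp only [Complex.add_re, Complex.add_im, Complex.ofReal_re, Complex.ofReal_im,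
    Complex.re_ofReal_mul, Complex.im_ofReal_mul, Complex.I_re, Complex.I_im, mul_zero, mul_one,
    add_zero, zero_add]

/-- On this line `cosh` becomes `i sinh`, so the oscillation disappears and the integrand is real
and positive. -/
lemma waveExp_add_pi_div_two (x ρ t : ℝ) :
    waveExp x ρ (t + ((Real.pi / 2 : ℝ) : ℂ) * Complex.I) =
      ((Real.exp (ρ * Real.sinh t ^ 2 - x * Real.sinh t) : ℝ) : ℂ) := by
  have hc : Complex.cosh (t + ((Real.pi / 2 : ℝ) : ℂ) * Complex.I) =
      Complex.sinh t * Complex.I := by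
    rw [Complex.cosh_add, Complex.cosh_mul_I, Complex.sinh_mul_I, ← Complex.ofReal_cos,
      ← Complex.ofReal_sin, Real.cos_pi_div_two, Real.sin_pi_div_two]
    simp
  rw [waveExp, hc, Complex.ofReal_exp]
  congr 1
  push_cast
  linear_combination (-(ρ : ℂ) * Complex.sinh t ^ 2 + x * Complex.sinh t) * Complex.I_sq

lemma norm_waveExp (x ρ a b : ℝ) : ‖waveExp x ρ (a + b * Complex.I)‖ =
    Real.exp (-ρ * (Real.cosh a ^ 2 * Real.cos b ^ 2 - Real.sinh a ^ 2 * Real.sin b ^ 2) -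
      x * Real.sinh a * Real.sin b) := by
  have : -(ρ : ℂ) * Complex.cosh (a + b * Complex.I) ^ 2 +
      Complex.I * x * Complex.cosh (a + b * Complex.I) =
      ((-ρ * (Real.cosh a ^ 2 * Real.cos b ^ 2 - Real.sinh a ^ 2 * Real.sin b ^ 2) -
        x * Real.sinh a * Real.sin b : ℝ) : ℂ) +
      ((-2 * ρ * Real.cosh a * Real.cos b * Real.sinh a * Real.sin b +
        x * Real.cosh a * Real.cos b : ℝ) : ℂ) * Complex.I := by
    rw [Complex.cosh_add, Complex.cosh_mul_I, Complex.sinh_mul_I]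
    push_cast
    linear_combination (-(ρ : ℂ) * (Complex.sinh a * Complex.sin b) ^ 2 +
      x * Complex.sinh a * Complex.sin b) * Complex.I_sq
  rw [waveExp, this, Complex.norm_exp]
  simp only [Complex.add_re, Complex.ofReal_re, Complex.re_ofReal_mul, Complex.I_re, mul_zero,
    add_zero]

/-- Real part of Cauchy's theorem on the rectangle `[0, a] × [0, π/2]`. -/
lemma integral_wave_rect (x ρ a : ℝ) :
    ∫ t in (0 : ℝ)..a, Real.exp (-ρ * Real.cosh t ^ 2) * Real.cos (x * Real.cosh t) =
      (∫ t in (0 : ℝ)..a, Real.exp (ρ * Real.sinh t ^ 2 - x * Real.sinh t)) -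
      (∫ b in (0 : ℝ)..(Real.pi / 2), Real.exp (-ρ * Real.cos b ^ 2) * Real.sin (x * Real.cos b)) +
      (∫ b in (0 : ℝ)..(Real.pi / 2), waveExp x ρ (a + b * Complex.I)).im := by
  have hc := (differentiable_waveExp x ρ).continuous
  have h := Complex.integral_boundary_rect_eq_zero_of_differentiableOn (waveExp x ρ) 0
    (a + ((Real.pi / 2 : ℝ) : ℂ) * Complex.I) (differentiable_waveExp x ρ).differentiableOn
  simp only [Complex.zero_re, Complex.zero_im, Complex.add_re, Complex.add_im, Complex.ofReal_re,
    Complex.ofReal_im, Complex.re_ofReal_mul, Complex.im_ofReal_mul, Complex.I_re, Complex.I_im,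
    mul_zero, mul_one, add_zero, zero_add, Complex.ofReal_zero, zero_mul,
    waveExp_add_pi_div_two, smul_eq_mul] at h
  rw [intervalIntegral.integral_ofReal] at h
  -- The vertical sides carry a factor `i`, so they contribute the imaginary parts of their
  -- integrals; the top side is already real.
  have hre := congrArg Complex.re h
  simp only [Complex.sub_re, Complex.add_re, Complex.I_mul_re, Complex.ofReal_re,
    Complex.zero_re] at hre
  have h1 : (∫ t in (0 : ℝ)..a, waveExp x ρ t).re =
      ∫ t in (0 : ℝ)..a, Real.exp (-ρ * Real.cosh t ^ 2) * Real.cos (x * Real.cosh t) := by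
    have := Complex.reCLM.intervalIntegral_comp_comm (μ := volume) (a := 0) (b := a)
      (f := fun t : ℝ => waveExp x ρ t)
      (Continuous.intervalIntegrable (by fun_prop) _ _)
    simp only [Complex.reCLM_apply, waveExp_ofReal_re] at this
    exact this.symm
  have h2 : (∫ b in (0 : ℝ)..(Real.pi / 2), waveExp x ρ (b * Complex.I)).im =
      ∫ b in (0 : ℝ)..(Real.pi / 2), Real.exp (-ρ * Real.cos b ^ 2) *
        Real.sin (x * Real.cos b) := by
    have := Complex.imCLM.intervalIntegral_comp_comm (μ := volume) (a := 0) (b := Real.pi / 2)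
      (f := fun b : ℝ => waveExp x ρ (b * Complex.I))
      (Continuous.intervalIntegrable (by fun_prop) _ _)
    simp only [Complex.imCLM_apply, waveExp_mul_I_im] at this
    exact this.symm
  rw [h1, h2] at hre
  linarith

/-! ### The exponentially small errors -/

lemma bigM_eq {x ρ : ℝ} (hρ : 0 < ρ) : bigM x ρ = ρ * (x / (2 * ρ)) ^ 2 := by
  rw [bigM]; field_simp; ring

/-- The side of the rectangle through the saddle point. -/
lemma abs_im_integral_waveExp_le {x ρ : ℝ} (hx : 0 < x) (hρ : 0 < ρ) :
    |(∫ b in (0 : ℝ)..(Real.pi / 2),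
      waveExp x ρ (Real.arsinh (x / (2 * ρ)) + b * Complex.I)).im| ≤
      Real.pi / 2 * Real.exp (-bigM x ρ) := by
  refine (Complex.abs_im_le_norm _).trans ?_
  have h := intervalIntegral.norm_integral_le_of_norm_le_const (a := 0) (b := Real.pi / 2)
    (C := Real.exp (-bigM x ρ))
    (f := fun b : ℝ => waveExp x ρ (Real.arsinh (x / (2 * ρ)) + b * Complex.I)) ?_
  · rw [sub_zero, abs_of_pos (by positivity)] at h
    exact h.trans_eq (mul_comm _ _)
  · intro b hb
    rw [uIoc_of_le (by positivity)] at hb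
    have hs0 : 0 ≤ Real.sin b :=
      Real.sin_nonneg_of_nonneg_of_le_pi hb.1.le (by linarith [hb.2, Real.pi_pos])
    have hs1 := Real.sin_le_one b
    rw [norm_waveExp, Real.exp_le_exp, Real.cosh_sq, Real.sinh_arsinh, Real.cos_sq', bigM_eq hρ]
    set y := x / (2 * ρ) with hy
    have hxy : x = 2 * ρ * y := by rw [hy]; field_simp
    rw [hxy]
    -- With `s = sin b` the exponent equals `-ρy² - ρ(1 - s²) - 2ρy² s(1 - s)`, where `ρy² = M`.
    have h1 : 0 ≤ ρ * y ^ 2 * (Real.sin b * (1 - Real.sin b)) := by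
      have : 0 ≤ 1 - Real.sin b := by linarith
      positivity
    have h2 : 0 ≤ ρ * (1 - Real.sin b ^ 2) := by
      have : 0 ≤ 1 - Real.sin b ^ 2 := by nlinarith
      positivity
    nlinarith

lemma integrable_wave (x : ℝ) {ρ : ℝ} (hρ : 0 < ρ) :
    Integrable fun t : ℝ => Real.exp (-ρ * Real.cosh t ^ 2) * Real.cos (x * Real.cosh t) := by
  refine Integrable.mono' (integrable_exp_neg_mul_sq hρ)
    (Continuous.aestronglyMeasurable (by fun_prop)) (ae_of_all _ fun t => ?_)
  rw [norm_mul, Real.norm_of_nonneg (Real.exp_pos _).le, Real.norm_eq_abs]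
  have h1 : t ^ 2 ≤ Real.cosh t ^ 2 := by
    rw [← sq_abs, ← Real.cosh_abs t]
    refine pow_le_pow_left₀ (abs_nonneg t) ?_ 2
    exact (Real.self_le_sinh_iff.2 (abs_nonneg t)).trans (Real.sinh_lt_cosh _).le
  calc _ ≤ Real.exp (-ρ * Real.cosh t ^ 2) * 1 := by gcongr; exact Real.abs_cos_le_one _
    _ ≤ Real.exp (-ρ * t ^ 2) := by
      rw [mul_one, Real.exp_le_exp]; nlinarith

lemma abs_integral_wave_tail_le {x ρ : ℝ} (hx : 0 < x) (hρ : 0 < ρ) :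
    |∫ t in Ioi (Real.arsinh (x / (2 * ρ))),
      Real.exp (-ρ * Real.cosh t ^ 2) * Real.cos (x * Real.cosh t)| ≤
      1 / 2 * ((bigM x ρ)⁻¹ * Real.exp (-bigM x ρ)) := by
  set y := x / (2 * ρ) with hy
  have hy0 : 0 < y := by positivity
  have hM : bigM x ρ = ρ * y ^ 2 := bigM_eq hρ
  -- Beyond `arsinh y` the weight `sinh t cosh t / y²` is at least 1, and inserting it makes the
  -- majorant an exact derivative. The factor `1/(2ρy²) = 1/(2M)` is the source of `M⁻¹`.
  have hd : ∀ t ∈ Ici (Real.arsinh y), HasDerivAt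
      (fun t => (2 * ρ * y ^ 2)⁻¹ * Real.exp (-ρ * Real.sinh t ^ 2))
      (-((Real.sinh t * Real.cosh t / y ^ 2) * Real.exp (-ρ * Real.sinh t ^ 2))) t := by
    intro t _
    refine (((((Real.hasDerivAt_sinh t).pow 2).const_mul (-ρ)).exp).const_mul _).congr_deriv ?_
    simp only [Pi.pow_apply]
    push_cast
    field_simp
  have hsh : ∀ t ∈ Ioi (Real.arsinh y), y ≤ Real.sinh t := by
    intro t ht
    rw [← Real.sinh_arsinh y]
    exact Real.sinh_le_sinh.2 (le_of_lt ht)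
  have hneg : ∀ t ∈ Ioi (Real.arsinh y),
      -((Real.sinh t * Real.cosh t / y ^ 2) * Real.exp (-ρ * Real.sinh t ^ 2)) ≤ 0 := by
    intro t ht
    have := hy0.trans_le (hsh t ht)
    have := Real.cosh_pos t
    rw [neg_nonpos]
    positivity
  have hlim : Tendsto (fun t => (2 * ρ * y ^ 2)⁻¹ * Real.exp (-ρ * Real.sinh t ^ 2)) atTop
      (𝓝 0) := by
    have h1 : Tendsto (fun t => Real.sinh t) atTop atTop := by
      refine tendsto_atTop_mono' _ ?_ tendsto_id
      filter_upwards [eventually_ge_atTop 0] with t ht using Real.self_le_sinh_iff.2 ht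
    have h2 : Tendsto (fun t => -ρ * Real.sinh t ^ 2) atTop atBot :=
      ((tendsto_pow_atTop two_ne_zero).comp h1).const_mul_atTop_of_neg (by linarith)
    have h3 := (Real.tendsto_exp_atBot.comp h2).const_mul (2 * ρ * y ^ 2)⁻¹
    rwa [mul_zero] at h3
  have hint := integrableOn_Ioi_deriv_of_nonpos' hd hneg hlim
  have hval := integral_Ioi_of_hasDerivAt_of_nonpos' hd hneg hlim
  have hint2 : IntegrableOn (fun t => (Real.sinh t * Real.cosh t / y ^ 2) *
      Real.exp (-ρ * Real.sinh t ^ 2)) (Ioi (Real.arsinh y)) := by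
    simpa using hint.neg
  rw [integral_neg, Real.sinh_arsinh, zero_sub, neg_inj] at hval
  calc _ ≤ ∫ t in Ioi (Real.arsinh y), (Real.sinh t * Real.cosh t / y ^ 2) *
        Real.exp (-ρ * Real.sinh t ^ 2) := by
        rw [← Real.norm_eq_abs]
        refine norm_integral_le_of_norm_le hint2
          ((ae_restrict_iff' measurableSet_Ioi).2 (ae_of_all _ fun t ht => ?_))
        have h1 := hsh t ht
        have h2 : Real.sinh t ≤ Real.cosh t := (Real.sinh_lt_cosh t).le
        have h3 : 1 ≤ Real.sinh t * Real.cosh t / y ^ 2 := by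
          rw [one_le_div (by positivity)]; nlinarith
        rw [norm_mul, Real.norm_of_nonneg (Real.exp_pos _).le, Real.norm_eq_abs]
        calc _ ≤ Real.exp (-ρ * Real.cosh t ^ 2) * 1 := by
              gcongr; exact Real.abs_cos_le_one _
          _ ≤ 1 * Real.exp (-ρ * Real.sinh t ^ 2) := by
              rw [mul_one, one_mul, Real.exp_le_exp, Real.cosh_sq]; nlinarith
          _ ≤ _ := by gcongr
    _ = _ := by
        rw [hval, hM, mul_inv, mul_inv, mul_inv, neg_mul]
        ring

/-! ### Reduction of `F` to the half-line -/

lemma integrand_zero (x ρ u : ℝ) : integrand x ρ 0 u =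
    ((Real.exp (ρ / 2) * (Real.exp (-ρ * Real.cosh u ^ 2) * Real.cos (x * Real.cosh u)) : ℝ) : ℂ) := by
  have : -((ρ : ℂ) / 2) * Complex.cosh (2 * u - Complex.I * ((0 : ℝ) : ℂ)) =
      ((ρ / 2 + -ρ * Real.cosh u ^ 2 : ℝ) : ℂ) := by
    have hs : Complex.sinh u ^ 2 = Complex.cosh u ^ 2 - 1 := Complex.sinh_sq _
    rw [Complex.ofReal_zero, mul_zero, sub_zero, Complex.cosh_two_mul, hs]
    push_cast
    ring
  rw [integrand, this, ← mul_assoc, ← Real.exp_add]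
  push_cast
  rfl

lemma integrable_integrand (x : ℝ) {ρ : ℝ} (hρ : 0 < ρ) : Integrable (integrand x ρ 0) := by
  have h := ((integrable_wave x hρ).const_mul (Real.exp (ρ / 2))).ofReal (𝕜 := ℂ)
  exact h.congr (ae_of_all _ fun u => (integrand_zero x ρ u).symm)

lemma F_zero_eq (x : ℝ) {ρ : ℝ} (hρ : 0 < ρ) (a : ℝ) : F x ρ 0 =
    ((2 * Real.exp (ρ / 2) * (
      (∫ t in (0 : ℝ)..a, Real.exp (-ρ * Real.cosh t ^ 2) * Real.cos (x * Real.cosh t)) +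
      ∫ t in Ioi a, Real.exp (-ρ * Real.cosh t ^ 2) * Real.cos (x * Real.cosh t)) : ℝ) : ℂ) := by
  have hi := integrable_wave x hρ
  rw [F]
  simp_rw [integrand_zero]
  rw [integral_complex_ofReal, integral_const_mul,
    intervalIntegral.integral_interval_add_Ioi hi.integrableOn hi.integrableOn]
  have h := integral_comp_abs
    (f := fun t => Real.exp (-ρ * Real.cosh t ^ 2) * Real.cos (x * Real.cosh t))
  simp only [Real.cosh_abs] at h
  rw [h]
  congr 1
  ring

/-! ### The asymptotic series and its remainder -/

/-- The indicator places the truncated integral on the same half-line as the `C_k`, so the remainder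
becomes a single integral. -/
lemma integral_exp_sinh_eq {x ρ y : ℝ} (hy : 0 < y) :
    ∫ t in (0 : ℝ)..(Real.arsinh y), Real.exp (ρ * Real.sinh t ^ 2 - x * Real.sinh t) =
      ∫ ξ in Ioi (0 : ℝ), (Iic y).indicator (fun ξ => Real.exp (ρ * ξ ^ 2)) ξ *
        (Real.exp (-x * ξ) / √(1 + ξ ^ 2)) := by
  have h := intervalIntegral.integral_comp_mul_deriv (a := 0) (b := y) (f := Real.arsinh)
    (f' := fun ξ => (√(1 + ξ ^ 2))⁻¹)
    (g := fun t => Real.exp (ρ * Real.sinh t ^ 2 - x * Real.sinh t))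
    (fun ξ _ => Real.hasDerivAt_arsinh ξ)
    (Continuous.continuousOn (Continuous.inv₀ (by fun_prop) fun ξ => by
      linarith [one_le_sqrt_one_add_sq ξ])) (by fun_prop)
  rw [Real.arsinh_zero] at h
  rw [← h, intervalIntegral.integral_of_le hy.le, ← Ioi_inter_Iic,
    ← setIntegral_indicator measurableSet_Iic]
  refine setIntegral_congr_fun measurableSet_Ioi fun ξ _ => ?_
  by_cases hξ : ξ ∈ Iic y
  · simp only [indicator_of_mem hξ, Function.comp, Real.sinh_arsinh]
    rw [sub_eq_add_neg, Real.exp_add, neg_mul]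
    ring
  · simp only [indicator_of_notMem hξ, zero_mul]

lemma asympSum_eq {x ρ : ℝ} (hx : 0 < x) (hρ : 0 < ρ) (n : ℕ) :
    IntegrableOn (fun ξ : ℝ => (∑ k ∈ Finset.range n, (ρ * ξ ^ 2) ^ k / (k.factorial : ℝ)) *
      (Real.exp (-x * ξ) / √(1 + ξ ^ 2))) (Ioi 0) ∧
    asympSum x ρ n = 2 / Real.pi * ∫ ξ in Ioi (0 : ℝ),
      (∑ k ∈ Finset.range n, (ρ * ξ ^ 2) ^ k / (k.factorial : ℝ)) *
        (Real.exp (-x * ξ) / √(1 + ξ ^ 2)) := by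
  have e : (fun ξ : ℝ => (∑ k ∈ Finset.range n, (ρ * ξ ^ 2) ^ k / (k.factorial : ℝ)) *
      (Real.exp (-x * ξ) / √(1 + ξ ^ 2))) =
      fun ξ => ∑ k ∈ Finset.range n, ρ ^ k / (k.factorial : ℝ) * coeffIntegrand k x ξ := by
    ext ξ
    rw [Finset.sum_mul]
    refine Finset.sum_congr rfl fun k _ => ?_
    rw [coeffIntegrand, mul_pow, ← pow_mul]
    ring
  have hi : ∀ k ∈ Finset.range n, IntegrableOn (fun ξ : ℝ =>
      ρ ^ k / (k.factorial : ℝ) * coeffIntegrand k x ξ) (Ioi 0) :=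
    fun k _ => (integrableOn_coeffIntegrand k hx).const_mul _
  rw [e]
  refine ⟨integrable_finsetSum _ hi, ?_⟩
  rw [integral_finsetSum _ hi, asympSum, Finset.mul_sum]
  refine Finset.sum_congr rfl fun k _ => ?_
  have hM : (bigM x ρ ^ k)⁻¹ = 2 ^ (2 * k) * ρ ^ k / x ^ (2 * k) := by
    rw [bigM, div_pow, inv_div, mul_pow, pow_mul, pow_mul]
    norm_num
  rw [integral_const_mul, coeffC, hM]
  field_simp

lemma abs_exp_sub_sum_le {z : ℝ} (hz : 0 ≤ z) (n : ℕ) :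
    |Real.exp z - ∑ k ∈ Finset.range n, z ^ k / (k.factorial : ℝ)| ≤ z ^ n * Real.exp z := by
  have h := Complex.norm_exp_sub_sum_le_norm_mul_exp (z : ℂ) n
  rw [Complex.norm_real, Real.norm_of_nonneg hz] at h
  rw [← Real.norm_eq_abs, ← Complex.norm_real]
  push_cast
  exact h

lemma sum_pow_div_factorial_le {z : ℝ} (hz : 1 ≤ z) (n : ℕ) :
    ∑ k ∈ Finset.range n, z ^ k / (k.factorial : ℝ) ≤ n * z ^ n := by
  calc _ ≤ ∑ _k ∈ Finset.range n, z ^ n := by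
        refine Finset.sum_le_sum fun k hk => ?_
        have h1 : (1 : ℝ) ≤ k.factorial := by exact_mod_cast Nat.factorial_pos _
        exact (div_le_self (by positivity) h1).trans
          (pow_le_pow_right₀ hz (Finset.mem_range.1 hk).le)
    _ = _ := by simp

/-- Up to the cut-off, `ρξ² ≤ xξ/2` controls the Taylor remainder. Past it only the partial sum is
left, and there `ρξ² ≥ M ≥ 1`, so each of its `n` terms is at most `(ρξ²)^n`. -/
lemma abs_indicator_exp_sub_sum_le {x ρ ξ : ℝ} (hx : 0 < x) (hρ : 0 < ρ) (hξ : 0 < ξ)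
    (hM : 1 ≤ bigM x ρ) (n : ℕ) :
    |(Iic (x / (2 * ρ))).indicator (fun ξ => Real.exp (ρ * ξ ^ 2)) ξ -
      ∑ k ∈ Finset.range n, (ρ * ξ ^ 2) ^ k / (k.factorial : ℝ)| ≤
      (n + 1) * (ρ * ξ ^ 2) ^ n * Real.exp (x / 2 * ξ) := by
  have hn : (0 : ℝ) ≤ n := n.cast_nonneg
  by_cases h : ξ ∈ Iic (x / (2 * ρ))
  · rw [indicator_of_mem h]
    have h1 : ρ * ξ ^ 2 ≤ x / 2 * ξ := by
      have h2 : ξ * (2 * ρ) ≤ x := (le_div_iff₀ (by positivity)).1 h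
      nlinarith
    calc _ ≤ (ρ * ξ ^ 2) ^ n * Real.exp (ρ * ξ ^ 2) := abs_exp_sub_sum_le (by positivity) n
      _ ≤ (ρ * ξ ^ 2) ^ n * Real.exp (x / 2 * ξ) := by gcongr
      _ ≤ _ := by
        rw [mul_assoc]
        exact le_mul_of_one_le_left (by positivity) (by linarith)
  · rw [indicator_of_notMem h, zero_sub, abs_neg, abs_of_nonneg (by positivity)]
    have h1 : x / (2 * ρ) < ξ := not_le.1 h
    have hz : 1 ≤ ρ * ξ ^ 2 := by
      refine hM.trans ?_
      rw [bigM_eq hρ]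
      gcongr
    calc _ ≤ n * (ρ * ξ ^ 2) ^ n := sum_pow_div_factorial_le hz n
      _ ≤ (n + 1) * (ρ * ξ ^ 2) ^ n := by gcongr; linarith
      _ ≤ _ := le_mul_of_one_le_right (by positivity) (Real.one_le_exp (by positivity))

lemma integral_pow_mul_exp_neg_mul (n : ℕ) {c : ℝ} (hc : 0 < c) :
    ∫ ξ in Ioi (0 : ℝ), ξ ^ n * Real.exp (-c * ξ) = n.factorial / c ^ (n + 1) := by
  have h := Real.integral_rpow_mul_exp_neg_mul_Ioi (a := n + 1) (r := c) (by positivity) hc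
  rw [Real.Gamma_nat_eq_factorial, ← Nat.cast_succ, Real.rpow_natCast] at h
  simp only [Nat.cast_succ, add_sub_cancel_right, Real.rpow_natCast] at h
  simp_rw [neg_mul]
  rw [h, div_pow, one_pow, Nat.succ_eq_add_one]
  ring

/-- The remainder of the truncated asymptotic series is `O(M^{-n})`. -/
lemma abs_asymp_remainder_le {x ρ : ℝ} (hx : 0 < x) (hρ : 0 < ρ) (hM : 1 ≤ bigM x ρ) (m : ℕ) :
    |2 / Real.pi * (∫ t in (0 : ℝ)..(Real.arsinh (x / (2 * ρ))),
        Real.exp (ρ * Real.sinh t ^ 2 - x * Real.sinh t)) - asympSum x ρ (m + 1)| ≤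
      2 / Real.pi * ((m + 2) * (2 * m + 1).factorial) * (bigM x ρ ^ (m + 1))⁻¹ := by
  have hy : 0 < x / (2 * ρ) := by positivity
  obtain ⟨hi, he⟩ := asympSum_eq hx hρ (m + 1)
  set w : ℝ → ℝ := fun ξ => Real.exp (-x * ξ) / √(1 + ξ ^ 2) with hw
  have hwc : Continuous w := by
    rw [hw]
    refine Continuous.div (by fun_prop) (by fun_prop) fun ξ => ?_
    linarith [one_le_sqrt_one_add_sq ξ]
  have hb : IntegrableOn (fun ξ : ℝ => ((m + 2) * ρ ^ (m + 1)) *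
      (ξ ^ (2 * m + 1) * Real.exp (-(x / 2) * ξ))) (Ioi 0) :=
    (integrableOn_pow_mul_exp_neg_mul (2 * m + 1) (by positivity : 0 < x / 2)).const_mul _
  have hle : ∀ ξ ∈ Ioi (0 : ℝ),
      ‖((Iic (x / (2 * ρ))).indicator (fun ξ => Real.exp (ρ * ξ ^ 2)) ξ -
        ∑ k ∈ Finset.range (m + 1), (ρ * ξ ^ 2) ^ k / (k.factorial : ℝ)) * w ξ‖ ≤
      ((m + 2) * ρ ^ (m + 1)) * (ξ ^ (2 * m + 1) * Real.exp (-(x / 2) * ξ)) := by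
    intro ξ hξ
    have hξ0 : (0 : ℝ) < ξ := hξ
    have h1 := abs_indicator_exp_sub_sum_le hx hρ hξ0 hM (m + 1)
    -- Bounding `1/√(1 + ξ²)` by `1/ξ` lowers the power to `ξ^{2m+1}`, whose Laplace integral scales
    -- as `(x/2)^{-(2m+2)}`. Together with `ρ^{m+1}` this is exactly `M^{-(m+1)}`; the bound by 1
    -- would leave a factor `1/x`, not uniform as `x → 0`.
    have h2 : w ξ ≤ Real.exp (-x * ξ) / ξ := by
      have : ξ ≤ √(1 + ξ ^ 2) := Real.le_sqrt_of_sq_le (by linarith)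
      simp only [hw]
      gcongr
    have h3 : 0 ≤ w ξ := by simp only [hw]; positivity
    rw [norm_mul, Real.norm_of_nonneg h3, Real.norm_eq_abs]
    calc _ ≤ (((m + 1 : ℕ) : ℝ) + 1) * (ρ * ξ ^ 2) ^ (m + 1) * Real.exp (x / 2 * ξ) *
          (Real.exp (-x * ξ) / ξ) := mul_le_mul h1 h2 h3 (by positivity)
      _ = _ := by
        rw [show -(x / 2) * ξ = x / 2 * ξ + -x * ξ by ring, Real.exp_add]
        push_cast
        field_simp
        ring
  have hmeas : AEStronglyMeasurable (fun ξ : ℝ =>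
      (Iic (x / (2 * ρ))).indicator (fun ξ => Real.exp (ρ * ξ ^ 2)) ξ * w ξ)
      (volume.restrict (Ioi 0)) := by
    refine AEStronglyMeasurable.mul ?_ hwc.aestronglyMeasurable
    exact ((by fun_prop : Continuous fun ξ : ℝ => Real.exp (ρ * ξ ^ 2)).measurable.indicator
      measurableSet_Iic).aestronglyMeasurable
  have hdiff : IntegrableOn (fun ξ : ℝ =>
      ((Iic (x / (2 * ρ))).indicator (fun ξ => Real.exp (ρ * ξ ^ 2)) ξ -
        ∑ k ∈ Finset.range (m + 1), (ρ * ξ ^ 2) ^ k / (k.factorial : ℝ)) * w ξ) (Ioi 0) := by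
    refine Integrable.mono' hb ?_ ((ae_restrict_iff' measurableSet_Ioi).2 (ae_of_all _ hle))
    refine (hmeas.sub hi.aestronglyMeasurable).congr (ae_of_all _ fun ξ => ?_)
    change _ * w ξ - _ * w ξ = _
    ring
  have hind : IntegrableOn (fun ξ : ℝ =>
      (Iic (x / (2 * ρ))).indicator (fun ξ => Real.exp (ρ * ξ ^ 2)) ξ * w ξ) (Ioi 0) := by
    refine (hdiff.add hi).congr (ae_of_all _ fun ξ => ?_)
    change _ * w ξ + _ * w ξ = _
    ring
  rw [he, integral_exp_sinh_eq hy, ← mul_sub, ← integral_sub hind hi, abs_mul,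
    abs_of_pos (by positivity : 0 < 2 / Real.pi), mul_assoc]
  gcongr
  rw [← Real.norm_eq_abs]
  refine (norm_integral_le_of_norm_le hb
    ((ae_restrict_iff' measurableSet_Ioi).2 (ae_of_all _ fun ξ hξ =>
      (congrArg norm (sub_mul _ _ (w ξ))).symm.trans_le (hle ξ hξ)))).trans_eq ?_
  rw [integral_const_mul, integral_pow_mul_exp_neg_mul _ (by positivity : 0 < x / 2), bigM,
    show 2 * m + 1 + 1 = 2 * (m + 1) by ring, pow_mul, ← inv_pow,
    show (x ^ 2 / (4 * ρ))⁻¹ = ρ / (x / 2) ^ 2 by field_simp; ring, div_pow ρ]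
  ring

lemma integral_exp_sin_sq_eq (x ρ : ℝ) :
    ∫ b in (0 : ℝ)..(Real.pi / 2), Real.exp (ρ * Real.sin b ^ 2) * Real.sin (x * Real.cos b) =
      Real.exp ρ * ∫ b in (0 : ℝ)..(Real.pi / 2), Real.exp (-ρ * Real.cos b ^ 2) *
        Real.sin (x * Real.cos b) := by
  rw [← intervalIntegral.integral_const_mul]
  refine intervalIntegral.integral_congr fun b _ => ?_
  rw [← mul_assoc, ← Real.exp_add, Real.sin_sq]
  ring_nf

end KelvinWave

end

theorem theorem1 :
    (∀ x : ℝ, 0 < x → ∀ m : ℕ,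
      MeasureTheory.IntegrableOn (KelvinWave.coeffIntegrand m x) (Set.Ioi 0) ∧
      KelvinWave.coeffC m x =
        2 ^ m * KelvinWave.poch (1 / 2) m * KelvinWave.scaledK m x -
          ∑ r ∈ Finset.range m,
            (m.choose r : ℝ) * x ^ (2 * (m - r)) * KelvinWave.coeffC r x) ∧
    (∀ X R : ℝ, 0 < X → 0 < R →
      ∃ (A B : ℝ) (K : ℕ → ℝ), ∀ x ρ : ℝ, 0 < x → x < X → 0 < ρ → ρ < R →
        MeasureTheory.Integrable (KelvinWave.integrand x ρ 0) ∧
        Summable (KelvinWave.struveTerm x ρ) ∧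
        ∀ n : ℕ, 1 ≤ n → (n : ℝ) < KelvinWave.bigM x ρ →
          ∃ E₁ E₂ E₃ : ℝ,
            |E₁| ≤ K n * (KelvinWave.bigM x ρ ^ n)⁻¹ ∧
            |E₂| ≤ A * Real.exp (-KelvinWave.bigM x ρ) ∧
            |E₃| ≤ B * ((KelvinWave.bigM x ρ)⁻¹ * Real.exp (-KelvinWave.bigM x ρ)) ∧
            KelvinWave.F x ρ 0 =
              ((-Real.pi * Real.exp (-ρ / 2) * ∑' r : ℕ, KelvinWave.struveTerm x ρ r
                + Real.pi * Real.exp (ρ / 2) * (KelvinWave.asympSum x ρ n + E₁)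
                + E₂ + E₃ : ℝ) : ℂ)) := by
  refine ⟨fun x hx m => ⟨KelvinWave.integrableOn_coeffIntegrand m hx,
    KelvinWave.coeffC_recurrence m hx⟩, fun X R _ hR => ?_⟩
  -- The prefactor `2 e^{ρ/2}` of `F` is at most `2 e^{R/2}`; `π/2` is the length of the right side
  -- and `1/2` the tail constant. The natural subtraction `2 * n - 1` is harmless as `n ≥ 1`.
  refine ⟨2 * Real.exp (R / 2) * (Real.pi / 2), 2 * Real.exp (R / 2) * (1 / 2),
    fun n => 2 / Real.pi * ((n + 1) * (2 * n - 1).factorial), ?_⟩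
  intro x ρ hx _ hρ hρR
  have hS := KelvinWave.hasSum_struveTerm hx ρ
  refine ⟨KelvinWave.integrable_integrand x hρ, hS.summable, fun n hn hnM => ?_⟩
  have hM : 1 ≤ KelvinWave.bigM x ρ := by
    have : (1 : ℝ) ≤ n := by exact_mod_cast hn
    linarith
  have hexp : Real.exp (ρ / 2) ≤ Real.exp (R / 2) := Real.exp_le_exp.2 (by linarith)
  obtain ⟨m, rfl⟩ : ∃ m, n = m + 1 := ⟨n - 1, by omega⟩
  have hscale : ∀ {a b c : ℝ}, |a| ≤ b * c →
      |2 * Real.exp (ρ / 2) * a| ≤ 2 * Real.exp (R / 2) * b * c := by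
    intro a b c h
    rw [abs_mul, abs_of_pos (by positivity), mul_assoc (2 * Real.exp (R / 2))]
    exact mul_le_mul (by gcongr) h (abs_nonneg _) (by positivity)
  -- The bounds determine the errors: `E₁` is the series remainder, `E₂` the right side of the
  -- rectangle and `E₃` the tail, the last two times `2 e^{ρ/2}`.
  refine ⟨_, _, _, (KelvinWave.abs_asymp_remainder_le hx hρ hM m).trans_eq ?_,
    hscale (KelvinWave.abs_im_integral_waveExp_le hx hρ),
    hscale (KelvinWave.abs_integral_wave_tail_le hx hρ), ?_⟩
  rotate_left
  · rw [KelvinWave.F_zero_eq x hρ (Real.arsinh (x / (2 * ρ))), KelvinWave.integral_wave_rect,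
      hS.tsum_eq, KelvinWave.integral_exp_sin_sq_eq]
    congr 1
    have h1 : Real.exp (-ρ / 2) * Real.exp ρ = Real.exp (ρ / 2) := by
      rw [← Real.exp_add]; congr 1; ring
    have halg : ∀ V S W T a : ℝ, 2 * Real.exp (ρ / 2) * (V - S + W + T) =
        -Real.pi * Real.exp (-ρ / 2) * (2 / Real.pi * (Real.exp ρ * S)) +
          Real.pi * Real.exp (ρ / 2) * (a + (2 / Real.pi * V - a)) +
          2 * Real.exp (ρ / 2) * W + 2 * Real.exp (ρ / 2) * T := by
      intro V S W T a
      rw [← h1]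
      field_simp
      ring
    exact halg _ _ _ _ _
  · beta_reduce
    rw [show 2 * (m + 1) - 1 = 2 * m + 1 by omega]
    push_cast
    ring
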